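/- Let $q$ be a complex number with $0<|q|<1$. For a nonnegative integer $n$ put $(x;q)_n=\prod_{i=0}^{n-1}(1-q^i x)$, let $J_1=\prod_{i\ge 1}(1-q^i)$, and let $$\chi_0(q)=\sum_{n\ge 0}\frac{q^n}{(q^{n+1};q)_n},\qquad \chi_1(q)=\sum_{n\ge 0}\frac{q^n}{(q^{n+1};q)_{n+1}}$$ be Ramanujan's fifth-order mock theta functions. For strictly positive integers $a,b,c,d,e,f$ and nonzero complex numbers $x,y,z$, let $$\mathfrak g_{a,b,c,d,e,f}(x,y,z,q)=\Big(\sum_{r,s,t\ge 0}+\sum_{r,s,t<0}\Big)(-1)^{r+s+t}x^r y^s z^t\,q^{a\binom r2+brs+c\binom s2+drt+est+f\binom t2},$$ where $r,s,t$ run over integers and $\binom r2=r(r-1)/2$. For $(a,b,c,d,e,f)=(1,2,1,2,2,1)$ and all nonzero complex $x,y,z$ both sums converge absolutely, the series $\chi_0(q)$ and $\chi_1(q)$ converge absolutely, the product $J_1$ converges unconditionally, and $$\begin{aligned} \mathfrak g_{1,2,1,2,2,1}(q^3,q^3,q^3,q)&=0,\\ \mathfrak g_{1,2,1,2,2,1}(q,q,q^2,q)&=J_1^2,\\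 \mathfrak g_{1,2,1,2,2,1}(q,q^2,q^2,q)&=J_1^2\,\chi_0(q),\\ \mathfrak g_{1,2,1,2,2,1}(q,q,q^3,q)&=J_1^2\,\big(q\chi_0(q)+1-q\big),\\ \mathfrak g_{1,2,1,2,2,1}(q,q^2,q^3,q)&=J_1^2\,\big(q\chi_1(q)+1\big). \end{aligned}$$ -/

import Mathlib

noncomputable section

/-- The finite `q`-Pochhammer symbol `(x; q)_n = ∏_{i=0}^{n-1} (1 - q^i x)`. -/
def qPoch (x q : ℂ) (n : ℕ) : ℂ := ∏ i ∈ Finset.range n, (1 - q ^ i * x)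

/-- The Euler product `J_m = ∏_{i ≥ 1} (1 - q^{m i})`. -/
def eulerJ (m : ℕ) (q : ℂ) : ℂ := ∏' i : ℕ, (1 - q ^ (m * (i + 1)))

/-- The `n`-th term `q^n / (q^{n+1}; q)_n` of Ramanujan's fifth order mock theta function `χ₀`. -/
def chi0Term (q : ℂ) (n : ℕ) : ℂ := q ^ n / qPoch (q ^ (n + 1)) q n

/-- The `n`-th term `q^n / (q^{n+1}; q)_{n+1}` of Ramanujan's fifth order mock theta
function `χ₁`. -/
def chi1Term (q : ℂ) (n : ℕ) : ℂ := q ^ n / qPoch (q ^ (n + 1)) q (n + 1)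

/-- Ramanujan's fifth order mock theta function `χ₀`. -/
def chi0 (q : ℂ) : ℂ := ∑' n : ℕ, chi0Term q n

/-- Ramanujan's fifth order mock theta function `χ₁`. -/
def chi1 (q : ℂ) : ℂ := ∑' n : ℕ, chi1Term q n

/-- The binomial coefficient `r (r - 1) / 2` of an integer `r` (the division is exact). -/
def intChooseTwo (r : ℤ) : ℤ := r * (r - 1) / 2

/-- The index set `r, s, t ≥ 0`. -/
def nonnegOctant : Set (ℤ × ℤ × ℤ) := {p | 0 ≤ p.1 ∧ 0 ≤ p.2.1 ∧ 0 ≤ p.2.2}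

/-- The index set `r, s, t < 0`. -/
def negOctant : Set (ℤ × ℤ × ℤ) := {p | p.1 < 0 ∧ p.2.1 < 0 ∧ p.2.2 < 0}

/-- The general term, at `p = (r, s, t)`, of the Hecke-type triple sum:
`(-1)^{r+s+t} x^r y^s z^t q^{a C(r,2) + b r s + c C(s,2) + d r t + e s t + f C(t,2)}`. -/
def heckeTripleTerm (a b c d e f : ℤ) (x y z q : ℂ) (p : ℤ × ℤ × ℤ) : ℂ :=
  (-1) ^ (p.1 + p.2.1 + p.2.2) * x ^ p.1 * y ^ p.2.1 * z ^ p.2.2 *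
    q ^ (a * intChooseTwo p.1 + b * p.1 * p.2.1 + c * intChooseTwo p.2.1 +
      d * p.1 * p.2.2 + e * p.2.1 * p.2.2 + f * intChooseTwo p.2.2)

/-- The Hecke-type triple sum `g_{a,b,c,d,e,f}(x,y,z,q)`: the sum of the general term over
`r, s, t ≥ 0` plus its sum over `r, s, t < 0`. -/
def heckeTriple (a b c d e f : ℤ) (x y z q : ℂ) : ℂ :=
  (∑' p : nonnegOctant, heckeTripleTerm a b c d e f x y z q p) +
    ∑' p : negOctant, heckeTripleTerm a b c d e f x y z q p

end

noncomputable section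

open Filter Topology

/-! ### Binomial coefficients and signs -/

/-! Write g for the triple sum, f for the double sum `heckeDouble`, J for J_1 and (q)_k for (q;q)_k.
Shifting r by one gives g(x,y,z) = -x g(qx,q²y,q²z) + f(y,z) (`heckeTriple_functional_eq`), and f
obeys an analogous relation whose inhomogeneous term is a full theta series, zero at integral powers
of q. With the reflections r ↦ -1-r, which also give g(q³,q³,q³) = 0, everything reduces to f(q,q),
g(q,q²,q²) and g(q²,q²,q²).

These three come from a Bailey-type argument. Let α_N = `heckeDiag q N` be the part of f(q,q) on the
line s+t = N. The finite identity ∑_N α_N / ((q)_{n-N} (q)_{n+e+N}) = (q)_n / (q)_{2n+e}, for e = 0,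
1, is proved by a recurrence in n for e = 0 (`binomSum_heckeDiag_eq`) and then transferred to e = 1
(`binomSum_heckeDiag_odd_eq`). Letting n → ∞ with e = 0 yields f(q,q) = J².

For the other two values, the octant indicator factors through N = s+t, so the sum over r becomes a
partial theta series depending only on N. That series is J² ∑_n q^n / ((q)_{n-N} (q)_{n+e+N}) up to
a power of q (`tsum_pow_mul_invPoch_int`). Exchanging the sums over N and n and inserting the finite
identity leaves J² ∑_n q^n (q)_n / (q)_{2n+e}, which is J² χ_0 for e = 0 and J² χ_1 for e = 1. -/

theorem two_mul_intChooseTwo (r : ℤ) : 2 * intChooseTwo r = r * (r - 1) :=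
  Int.mul_ediv_cancel' (Int.even_mul_pred_self r).two_dvd

theorem intChooseTwo_sub_one (r : ℤ) : intChooseTwo (r - 1) = intChooseTwo r - r + 1 := by
  have h := two_mul_intChooseTwo r
  have h' := two_mul_intChooseTwo (r - 1)
  linarith

theorem intChooseTwo_add_one (r : ℤ) : intChooseTwo (r + 1) = intChooseTwo r + r := by
  have h := two_mul_intChooseTwo r
  have h' := two_mul_intChooseTwo (r + 1)
  linarith

theorem intChooseTwo_neg (r : ℤ) : intChooseTwo (-r) = intChooseTwo r + r := by
  have h := two_mul_intChooseTwo r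
  have h' := two_mul_intChooseTwo (-r)
  linarith

theorem intChooseTwo_neg_one_sub (r : ℤ) : intChooseTwo (-1 - r) = intChooseTwo r + 2 * r + 1 := by
  have h := two_mul_intChooseTwo r
  have h' := two_mul_intChooseTwo (-1 - r)
  linarith

theorem intChooseTwo_add (r s : ℤ) :
    intChooseTwo (r + s) = intChooseTwo r + intChooseTwo s + r * s := by
  have h := two_mul_intChooseTwo r
  have h' := two_mul_intChooseTwo s
  have h'' := two_mul_intChooseTwo (r + s)
  linarith

@[simp] theorem intChooseTwo_zero : intChooseTwo 0 = 0 := rfl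

/-- The sign of a quadrant: `1` on `r, s ≥ 0`, `-1` on `r, s < 0`, and `0` elsewhere. -/
def quadrantSign (r s : ℤ) : ℂ := if 0 ≤ r ∧ 0 ≤ s then 1 else if r < 0 ∧ s < 0 then -1 else 0

/-- The indicator function of the octants `r, s, t ≥ 0` and `r, s, t < 0`. -/
def octantInd (r s t : ℤ) : ℂ :=
  if 0 ≤ r ∧ 0 ≤ s ∧ 0 ≤ t then 1 else if r < 0 ∧ s < 0 ∧ t < 0 then 1 else 0

theorem quadrantSign_comm (r s : ℤ) : quadrantSign r s = quadrantSign s r := by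
  unfold quadrantSign; simp only [and_comm]

theorem quadrantSign_neg_one_sub (r s : ℤ) :
    quadrantSign (-1 - r) (-1 - s) = -quadrantSign r s := by
  unfold quadrantSign
  split_ifs <;> first | omega | simp

theorem octantInd_neg_one_sub (r s t : ℤ) :
    octantInd (-1 - r) (-1 - s) (-1 - t) = octantInd r s t := by
  unfold octantInd
  split_ifs <;> first | omega | simp

theorem quadrantSign_sub_one_left (r s : ℤ) :
    quadrantSign r s - quadrantSign (r - 1) s = if r = 0 then 1 else 0 := by
  unfold quadrantSign
  split_ifs <;> first | omega | simp

theorem quadrantSign_sub_one_sub_one (r s : ℤ) :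
    quadrantSign r s - quadrantSign (r - 1) (s - 1) =
      (if r = 0 then 1 else 0) + if s = 0 then 1 else 0 := by
  unfold quadrantSign
  split_ifs <;> first | omega | norm_num

theorem octantInd_sub_one_left (r s t : ℤ) :
    octantInd r s t - octantInd (r - 1) s t = if r = 0 then quadrantSign s t else 0 := by
  unfold octantInd quadrantSign
  split_ifs <;> first | omega | simp

/-- When s and t lie on the same side, s + t lies there too, and the two minus signs of the negative
octant cancel. This makes the sum over r depend on s and t only through s + t, apart from the
double-sum term. -/
theorem octantInd_eq_mul (r s t : ℤ) :
    octantInd r s t = quadrantSign r (s + t) * quadrantSign s t := by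
  unfold octantInd quadrantSign
  split_ifs <;> first | omega | simp

theorem norm_quadrantSign_le (r s : ℤ) : ‖quadrantSign r s‖ ≤ 1 := by
  unfold quadrantSign
  split_ifs <;> simp

theorem norm_octantInd_le (r s t : ℤ) : ‖octantInd r s t‖ ≤ 1 := by
  unfold octantInd
  split_ifs <;> simp

/-! ### Convergence -/

theorem summable_nat_pow_mul_pow_choose {a b : ℝ} (ha : 0 < a) (hb : 0 < b) (hb1 : b < 1) :
    Summable fun n : ℕ => a ^ (n : ℤ) * b ^ intChooseTwo n := by
  have hpos : ∀ n : ℕ, 0 < a ^ (n : ℤ) * b ^ intChooseTwo n := fun n => by positivity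
  refine summable_of_ratio_test_tendsto_lt_one (l := 0) one_pos
    (Eventually.of_forall fun n => (hpos n).ne') ?_
  have h : Tendsto (fun n : ℕ => a * b ^ n) atTop (𝓝 (a * 0)) :=
    (tendsto_pow_atTop_nhds_zero_of_lt_one hb.le hb1).const_mul a
  rw [mul_zero] at h
  refine h.congr fun n => ?_
  rw [Real.norm_of_nonneg (hpos _).le, Real.norm_of_nonneg (hpos _).le, eq_div_iff (hpos n).ne']
  push_cast
  rw [intChooseTwo_add_one, zpow_add₀ ha.ne', zpow_add₀ hb.ne', zpow_one, zpow_natCast b]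
  ring

theorem summable_zpow_mul_zpow_choose {a b : ℝ} (ha : 0 < a) (hb : 0 < b) (hb1 : b < 1) :
    Summable fun n : ℤ => a ^ n * b ^ intChooseTwo n := by
  refine Summable.of_nat_of_neg (summable_nat_pow_mul_pow_choose ha hb hb1) ?_
  refine (summable_nat_pow_mul_pow_choose (a := b / a) (by positivity) hb hb1).congr fun n => ?_
  rw [intChooseTwo_neg, zpow_add₀ hb.ne', div_zpow, zpow_neg]
  field_simp

/-- The term of the double sum `f_{1,2,1}(x, y, q)`, without its sign. -/
def heckeDoubleTerm (x y q : ℂ) (r s : ℤ) : ℂ :=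
  (-1) ^ (r + s) * x ^ r * y ^ s * q ^ (intChooseTwo r + 2 * r * s + intChooseTwo s)

/-- The Hecke-type double sum `f_{1,2,1}(x, y, q)`. -/
def heckeDouble (x y q : ℂ) : ℂ :=
  ∑' p : ℤ × ℤ, quadrantSign p.1 p.2 * heckeDoubleTerm x y q p.1 p.2

/-- The theta-type term `(-1)^n x^n q^{n(n-1)/2}`. -/
def thetaTerm (x q : ℂ) (n : ℤ) : ℂ := (-1) ^ n * x ^ n * q ^ intChooseTwo n

theorem norm_neg_one_zpow (n : ℤ) : ‖(-1 : ℂ) ^ n‖ = 1 := by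
  rw [norm_zpow, norm_neg, norm_one, one_zpow]

theorem norm_thetaTerm (x q : ℂ) (n : ℤ) :
    ‖thetaTerm x q n‖ = ‖x‖ ^ n * ‖q‖ ^ intChooseTwo n := by
  rw [thetaTerm, norm_mul, norm_mul, norm_neg_one_zpow, one_mul, norm_zpow, norm_zpow]

theorem heckeTripleTerm_sub_one {x y z q : ℂ} (hq0 : q ≠ 0) (hx : x ≠ 0) (r s t : ℤ) :
    x * heckeTripleTerm 1 2 1 2 2 1 (q * x) (q ^ 2 * y) (q ^ 2 * z) q (r - 1, s, t) =
      -heckeTripleTerm 1 2 1 2 2 1 x y z q (r, s, t) := by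
  have h1 : (-1 : ℂ) ^ (r - 1 + s + t) = -(-1) ^ (r + s + t) := by
    rw [show r - 1 + s + t = r + s + t - 1 by ring, zpow_sub_one₀ (by norm_num)]
    norm_num
  have h2 : q ^ (1 * intChooseTwo r + 2 * r * s + 1 * intChooseTwo s + 2 * r * t + 2 * s * t
      + 1 * intChooseTwo t) = q ^ (r - 1) * (q ^ 2) ^ s * (q ^ 2) ^ t *
      q ^ (1 * intChooseTwo (r - 1) + 2 * (r - 1) * s + 1 * intChooseTwo s + 2 * (r - 1) * t
        + 2 * s * t + 1 * intChooseTwo t) := by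
    rw [← zpow_natCast, ← zpow_mul, ← zpow_mul, ← zpow_add₀ hq0, ← zpow_add₀ hq0, ← zpow_add₀ hq0,
      intChooseTwo_sub_one]
    congr 1
    push_cast
    ring
  simp only [heckeTripleTerm]
  rw [h1, h2, mul_zpow, mul_zpow, mul_zpow, zpow_sub_one₀ hx]
  field_simp

theorem heckeDoubleTerm_sub_one {x y q : ℂ} (hq0 : q ≠ 0) (hx : x ≠ 0) (r s : ℤ) :
    x * heckeDoubleTerm (q * x) (q ^ 2 * y) q (r - 1) s = -heckeDoubleTerm x y q r s := by
  have h1 : (-1 : ℂ) ^ (r - 1 + s) = -(-1) ^ (r + s) := by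
    rw [show r - 1 + s = r + s - 1 by ring, zpow_sub_one₀ (by norm_num)]
    norm_num
  have h2 : q ^ (intChooseTwo r + 2 * r * s + intChooseTwo s) = q ^ (r - 1) * (q ^ 2) ^ s *
      q ^ (intChooseTwo (r - 1) + 2 * (r - 1) * s + intChooseTwo s) := by
    rw [← zpow_natCast, ← zpow_mul, ← zpow_add₀ hq0, ← zpow_add₀ hq0, intChooseTwo_sub_one]
    congr 1
    push_cast
    ring
  simp only [heckeDoubleTerm]
  rw [h1, h2, mul_zpow, mul_zpow, zpow_sub_one₀ hx]
  field_simp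

section Convergence

variable {q : ℂ} (hq0 : q ≠ 0) (hq1 : ‖q‖ < 1)
include hq0 hq1

theorem summable_norm_thetaTerm {x : ℂ} (hx : x ≠ 0) : Summable fun n => ‖thetaTerm x q n‖ := by
  simp only [norm_thetaTerm]
  exact summable_zpow_mul_zpow_choose (norm_pos_iff.2 hx) (norm_pos_iff.2 hq0) hq1

theorem summable_thetaTerm {x : ℂ} (hx : x ≠ 0) : Summable (thetaTerm x q) :=
  (summable_norm_thetaTerm hq0 hq1 hx).of_norm

/-- On the support rs ≥ 0, so the cross term in the exponent only shrinks the modulus and a product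
of two theta series dominates. -/
theorem norm_quadrantSign_mul_heckeDoubleTerm_le (x y : ℂ) (r s : ℤ) :
    ‖quadrantSign r s * heckeDoubleTerm x y q r s‖ ≤ ‖thetaTerm x q r‖ * ‖thetaTerm y q s‖ := by
  by_cases h : (0 ≤ r ∧ 0 ≤ s) ∨ (r < 0 ∧ s < 0)
  · have hrs : 0 ≤ r * s := by
      rcases h with h | h
      · exact mul_nonneg h.1 h.2
      · exact (mul_pos_of_neg_of_neg h.1 h.2).le
    have hle : ‖q‖ ^ (intChooseTwo r + 2 * r * s + intChooseTwo s) ≤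
        ‖q‖ ^ (intChooseTwo r + intChooseTwo s) :=
      zpow_le_zpow_right_of_le_one₀ (norm_pos_iff.2 hq0) hq1.le (by linarith)
    rw [norm_mul, heckeDoubleTerm, norm_mul, norm_mul, norm_mul, norm_neg_one_zpow, one_mul,
      norm_zpow, norm_zpow, norm_zpow, norm_thetaTerm, norm_thetaTerm]
    calc _ ≤ 1 * (‖x‖ ^ r * ‖y‖ ^ s * ‖q‖ ^ (intChooseTwo r + intChooseTwo s)) := by
          gcongr
          exact norm_quadrantSign_le r s
      _ = _ := by
          rw [zpow_add₀ (norm_ne_zero_iff.2 hq0)]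
          ring
  · have : quadrantSign r s = 0 := by
      unfold quadrantSign
      split_ifs <;> first | omega | rfl
    rw [this, zero_mul, norm_zero]
    positivity

theorem norm_octantInd_mul_heckeTripleTerm_le (x y z : ℂ) (r s t : ℤ) :
    ‖octantInd r s t * heckeTripleTerm 1 2 1 2 2 1 x y z q (r, s, t)‖ ≤
      ‖thetaTerm x q r‖ * (‖thetaTerm y q s‖ * ‖thetaTerm z q t‖) := by
  by_cases h : (0 ≤ r ∧ 0 ≤ s ∧ 0 ≤ t) ∨ (r < 0 ∧ s < 0 ∧ t < 0)
  · have hrs : 0 ≤ r * s + r * t + s * t := by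
      rcases h with ⟨h1, h2, h3⟩ | ⟨h1, h2, h3⟩
      · positivity
      · have := mul_pos_of_neg_of_neg h1 h2
        have := mul_pos_of_neg_of_neg h1 h3
        have := mul_pos_of_neg_of_neg h2 h3
        linarith
    have hle : ‖q‖ ^ (1 * intChooseTwo r + 2 * r * s + 1 * intChooseTwo s + 2 * r * t + 2 * s * t
          + 1 * intChooseTwo t) ≤
        ‖q‖ ^ (intChooseTwo r + intChooseTwo s + intChooseTwo t) :=
      zpow_le_zpow_right_of_le_one₀ (norm_pos_iff.2 hq0) hq1.le (by linarith)
    rw [norm_mul, heckeTripleTerm, norm_mul, norm_mul, norm_mul, norm_mul, norm_neg_one_zpow,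
      one_mul, norm_zpow, norm_zpow, norm_zpow, norm_zpow, norm_thetaTerm, norm_thetaTerm,
      norm_thetaTerm]
    calc _ ≤ 1 * (‖x‖ ^ r * ‖y‖ ^ s * ‖z‖ ^ t *
          ‖q‖ ^ (intChooseTwo r + intChooseTwo s + intChooseTwo t)) := by
          gcongr
          exact norm_octantInd_le r s t
      _ = _ := by
          rw [zpow_add₀ (norm_ne_zero_iff.2 hq0), zpow_add₀ (norm_ne_zero_iff.2 hq0)]
          ring
  · have : octantInd r s t = 0 := by
      unfold octantInd
      split_ifs <;> first | omega | rfl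
    rw [this, zero_mul, norm_zero]
    positivity

theorem summable_norm_heckeDouble {x y : ℂ} (hx : x ≠ 0) (hy : y ≠ 0) :
    Summable fun p : ℤ × ℤ => ‖quadrantSign p.1 p.2 * heckeDoubleTerm x y q p.1 p.2‖ :=
  Summable.of_nonneg_of_le (fun _ => norm_nonneg _)
    (fun p => norm_quadrantSign_mul_heckeDoubleTerm_le hq0 hq1 x y p.1 p.2)
    ((summable_norm_thetaTerm hq0 hq1 hx).mul_of_nonneg (summable_norm_thetaTerm hq0 hq1 hy)
      (fun _ => norm_nonneg _) (fun _ => norm_nonneg _))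

theorem summable_heckeDouble {x y : ℂ} (hx : x ≠ 0) (hy : y ≠ 0) :
    Summable fun p : ℤ × ℤ => quadrantSign p.1 p.2 * heckeDoubleTerm x y q p.1 p.2 :=
  (summable_norm_heckeDouble hq0 hq1 hx hy).of_norm

theorem summable_heckeTriple {x y z : ℂ} (hx : x ≠ 0) (hy : y ≠ 0) (hz : z ≠ 0) :
    Summable fun p : ℤ × ℤ × ℤ =>
      octantInd p.1 p.2.1 p.2.2 * heckeTripleTerm 1 2 1 2 2 1 x y z q p := by
  refine Summable.of_norm_bounded (g := fun p : ℤ × ℤ × ℤ =>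
    ‖thetaTerm x q p.1‖ * (‖thetaTerm y q p.2.1‖ * ‖thetaTerm z q p.2.2‖)) ?_
    fun p => norm_octantInd_mul_heckeTripleTerm_le hq0 hq1 x y z p.1 p.2.1 p.2.2
  have h := (summable_norm_thetaTerm hq0 hq1 hy).mul_of_nonneg (summable_norm_thetaTerm hq0 hq1 hz)
      (fun _ => norm_nonneg _) (fun _ => norm_nonneg _)
  exact (summable_norm_thetaTerm hq0 hq1 hx).mul_of_nonneg h
      (fun _ => norm_nonneg _) (fun _ => by positivity)

theorem summable_nonnegOctant {x y z : ℂ} (hx : x ≠ 0) (hy : y ≠ 0) (hz : z ≠ 0) :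
    Summable fun p : nonnegOctant => heckeTripleTerm 1 2 1 2 2 1 x y z q p := by
  refine ((summable_heckeTriple hq0 hq1 hx hy hz).comp_injective
    (Subtype.val_injective (p := (· ∈ nonnegOctant)))).congr fun p => ?_
  have hp := p.2
  simp only [nonnegOctant, Set.mem_ofPred_eq] at hp
  simp [octantInd, hp]

theorem summable_negOctant {x y z : ℂ} (hx : x ≠ 0) (hy : y ≠ 0) (hz : z ≠ 0) :
    Summable fun p : negOctant => heckeTripleTerm 1 2 1 2 2 1 x y z q p := by
  refine ((summable_heckeTriple hq0 hq1 hx hy hz).comp_injective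
    (Subtype.val_injective (p := (· ∈ negOctant)))).congr fun p => ?_
  have hp := p.2
  simp only [negOctant, Set.mem_ofPred_eq] at hp
  simp [octantInd, hp]

theorem heckeTriple_eq_tsum {x y z : ℂ} (hx : x ≠ 0) (hy : y ≠ 0) (hz : z ≠ 0) :
    heckeTriple 1 2 1 2 2 1 x y z q = ∑' p : ℤ × ℤ × ℤ,
      octantInd p.1 p.2.1 p.2.2 * heckeTripleTerm 1 2 1 2 2 1 x y z q p := by
  have h1 := (summable_subtype_iff_indicator (s := nonnegOctant)
    (f := heckeTripleTerm 1 2 1 2 2 1 x y z q)).1 (summable_nonnegOctant hq0 hq1 hx hy hz)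
  have h2 := (summable_subtype_iff_indicator (s := negOctant)
    (f := heckeTripleTerm 1 2 1 2 2 1 x y z q)).1 (summable_negOctant hq0 hq1 hx hy hz)
  rw [heckeTriple, tsum_subtype nonnegOctant (heckeTripleTerm 1 2 1 2 2 1 x y z q),
    tsum_subtype negOctant (heckeTripleTerm 1 2 1 2 2 1 x y z q), ← h1.tsum_add h2]
  refine tsum_congr fun p => ?_
  by_cases hp : 0 ≤ p.1 ∧ 0 ≤ p.2.1 ∧ 0 ≤ p.2.2
  · have hn : p ∉ negOctant := fun h : p.1 < 0 ∧ p.2.1 < 0 ∧ p.2.2 < 0 => by omega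
    rw [Set.indicator_of_mem (show p ∈ nonnegOctant from hp), Set.indicator_of_notMem hn,
      octantInd, if_pos hp, one_mul, add_zero]
  · rw [Set.indicator_of_notMem (show p ∉ nonnegOctant from hp), octantInd, if_neg hp, zero_add]
    by_cases hn : p.1 < 0 ∧ p.2.1 < 0 ∧ p.2.2 < 0
    · rw [Set.indicator_of_mem (show p ∈ negOctant from hn), if_pos hn, one_mul]
    · rw [Set.indicator_of_notMem (show p ∉ negOctant from hn), if_neg hn, zero_mul]

/-! ### Functional equations -/

/-- The shift r ↦ r - 1 turns one general term into minus the other, so only the difference of the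
two octant indicators survives. It lives on r = 0 and equals the quadrant sign there. -/
theorem heckeTriple_functional_eq {x y z : ℂ} (hx : x ≠ 0) (hy : y ≠ 0) (hz : z ≠ 0) :
    heckeTriple 1 2 1 2 2 1 x y z q =
      -x * heckeTriple 1 2 1 2 2 1 (q * x) (q ^ 2 * y) (q ^ 2 * z) q + heckeDouble y z q := by
  have hx' : q * x ≠ 0 := mul_ne_zero hq0 hx
  have hy' : q ^ 2 * y ≠ 0 := mul_ne_zero (pow_ne_zero 2 hq0) hy
  have hz' : q ^ 2 * z ≠ 0 := mul_ne_zero (pow_ne_zero 2 hq0) hz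
  let e : ℤ × ℤ × ℤ ≃ ℤ × ℤ × ℤ := (Equiv.subRight 1).prodCongr (Equiv.refl _)
  have hs := summable_heckeTriple hq0 hq1 hx hy hz
  have hs' := (e.summable_iff.2 (summable_heckeTriple hq0 hq1 hx' hy' hz')).mul_left x
  rw [heckeTriple_eq_tsum hq0 hq1 hx hy hz, heckeTriple_eq_tsum hq0 hq1 hx' hy' hz',
    ← e.tsum_eq (fun p : ℤ × ℤ × ℤ => octantInd p.1 p.2.1 p.2.2 *
      heckeTripleTerm 1 2 1 2 2 1 (q * x) (q ^ 2 * y) (q ^ 2 * z) q p), neg_mul,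
    ← tsum_mul_left, eq_neg_add_iff_add_eq, add_comm]
  refine (hs.tsum_add hs').symm.trans ?_
  have hterm : ∀ p : ℤ × ℤ × ℤ,
      octantInd p.1 p.2.1 p.2.2 * heckeTripleTerm 1 2 1 2 2 1 x y z q p +
        x * (octantInd (p.1 - 1) p.2.1 p.2.2 *
          heckeTripleTerm 1 2 1 2 2 1 (q * x) (q ^ 2 * y) (q ^ 2 * z) q (p.1 - 1, p.2.1, p.2.2)) =
      if p.1 = 0 then quadrantSign p.2.1 p.2.2 * heckeDoubleTerm y z q p.2.1 p.2.2 else 0 := by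
    rintro ⟨r, s, t⟩
    have h := octantInd_sub_one_left r s t
    have h' := heckeTripleTerm_sub_one hq0 (y := y) (z := z) hx r s t
    rw [mul_left_comm, h', mul_neg, ← sub_eq_add_neg, ← sub_mul, h]
    split_ifs with hr
    · obtain rfl : r = 0 := hr
      simp [heckeTripleTerm, heckeDoubleTerm]
    · exact zero_mul _
  have hinj : Function.Injective (fun p : ℤ × ℤ => ((0 : ℤ), p)) := fun a b h => by simpa using h
  refine (tsum_congr hterm).trans ?_
  rw [← hinj.tsum_eq]
  · simp [heckeDouble]
  · rintro ⟨r, p⟩ h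
    have : r = 0 := by
      by_contra hr
      simp [hr] at h
    exact ⟨p, by rw [this]⟩

theorem heckeDouble_functional_eq {x y : ℂ} (hx : x ≠ 0) (hy : y ≠ 0) :
    heckeDouble x y q =
      -x * heckeDouble (q * x) (q ^ 2 * y) q + ∑' n, thetaTerm y q n := by
  have hx' : q * x ≠ 0 := mul_ne_zero hq0 hx
  have hy' : q ^ 2 * y ≠ 0 := mul_ne_zero (pow_ne_zero 2 hq0) hy
  let e : ℤ × ℤ ≃ ℤ × ℤ := (Equiv.subRight 1).prodCongr (Equiv.refl _)
  have hs := summable_heckeDouble hq0 hq1 hx hy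
  have hs' := (e.summable_iff.2 (summable_heckeDouble hq0 hq1 hx' hy')).mul_left x
  rw [heckeDouble, heckeDouble, ← e.tsum_eq (fun p : ℤ × ℤ =>
      quadrantSign p.1 p.2 * heckeDoubleTerm (q * x) (q ^ 2 * y) q p.1 p.2), neg_mul,
    ← tsum_mul_left, eq_neg_add_iff_add_eq, add_comm]
  refine (hs.tsum_add hs').symm.trans ?_
  have hterm : ∀ p : ℤ × ℤ,
      quadrantSign p.1 p.2 * heckeDoubleTerm x y q p.1 p.2 +
        x * (quadrantSign (p.1 - 1) p.2 * heckeDoubleTerm (q * x) (q ^ 2 * y) q (p.1 - 1) p.2) =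
      if p.1 = 0 then thetaTerm y q p.2 else 0 := by
    rintro ⟨r, s⟩
    have h := quadrantSign_sub_one_left r s
    have h' := heckeDoubleTerm_sub_one hq0 (y := y) hx r s
    rw [mul_left_comm, h', mul_neg, ← sub_eq_add_neg, ← sub_mul, h]
    split_ifs with hr
    · obtain rfl : r = 0 := hr
      simp [thetaTerm, heckeDoubleTerm]
    · exact zero_mul _
  have hinj : Function.Injective (fun s : ℤ => ((0 : ℤ), s)) := fun a b h => by simpa using h
  refine (tsum_congr hterm).trans ?_
  rw [← hinj.tsum_eq]
  · simp
  · rintro ⟨r, p⟩ h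
    have : r = 0 := by
      by_contra hr
      simp [hr] at h
    exact ⟨p, by rw [this]⟩

end Convergence

/-! ### Symmetries -/

theorem neg_one_zpow_eq_of_even {m n : ℤ} (h : Even (m + n)) : (-1 : ℂ) ^ m = (-1) ^ n := by
  rcases Int.even_or_odd n with hn | hn
  · rw [hn.neg_one_zpow, ((Int.even_add.1 h).2 hn).neg_one_zpow]
  · have hm : Odd m := by
      rw [← Int.not_even_iff_odd] at hn ⊢
      exact fun hm => hn ((Int.even_add.1 h).1 hm)
    rw [hn.neg_one_zpow, hm.neg_one_zpow]

theorem neg_one_zpow_eq_of_odd {m n : ℤ} (h : Odd (m + n)) : (-1 : ℂ) ^ m = -(-1) ^ n := by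
  have h' : Even (m + (n + 1)) := by
    rw [← add_assoc]
    exact h.add_one
  rw [neg_one_zpow_eq_of_even h', zpow_add_one₀ (by norm_num)]
  ring

theorem heckeDouble_comm (x y q : ℂ) : heckeDouble x y q = heckeDouble y x q := by
  rw [heckeDouble, heckeDouble, ← (Equiv.prodComm ℤ ℤ).tsum_eq]
  refine tsum_congr fun ⟨r, s⟩ => ?_
  simp only [Equiv.prodComm_apply, Prod.fst_swap, Prod.snd_swap, heckeDoubleTerm]
  rw [quadrantSign_comm, add_comm s r, show intChooseTwo s + 2 * s * r + intChooseTwo r =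
    intChooseTwo r + 2 * r * s + intChooseTwo s by ring]
  ring

section Symmetry

variable {q : ℂ} (hq0 : q ≠ 0)
include hq0

/-- Substitute (r, s) ↦ (-1-r, -1-s), which swaps the two quadrants and hence flips the sign. -/
theorem heckeDouble_zpow_reflect (a b : ℤ) :
    heckeDouble (q ^ a) (q ^ b) q =
      -q ^ (4 - a - b) * heckeDouble (q ^ (4 - a)) (q ^ (4 - b)) q := by
  rw [heckeDouble, heckeDouble,
    ← ((Equiv.subLeft (-1 : ℤ)).prodCongr (Equiv.subLeft (-1 : ℤ))).tsum_eq, neg_mul,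
    ← tsum_mul_left, ← tsum_neg]
  refine tsum_congr fun ⟨r, s⟩ => ?_
  simp only [Equiv.prodCongr_apply, Prod.map, Equiv.subLeft_apply, quadrantSign_neg_one_sub,
    heckeDoubleTerm, ← zpow_mul]
  rw [neg_one_zpow_eq_of_even (m := -1 - r + (-1 - s)) (n := r + s) ⟨-1, by ring⟩,
    neg_mul, neg_inj, mul_left_comm (q ^ (4 - a - b))]
  congr 1
  simp only [mul_assoc]
  rw [mul_left_comm (q ^ (4 - a - b))]
  congr 1
  simp only [← zpow_add₀ hq0]
  rw [intChooseTwo_neg_one_sub, intChooseTwo_neg_one_sub]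
  congr 1
  ring

theorem heckeTriple_cube_term_reflect (r s t : ℤ) :
    heckeTripleTerm 1 2 1 2 2 1 (q ^ 3) (q ^ 3) (q ^ 3) q (-1 - r, -1 - s, -1 - t) =
      -heckeTripleTerm 1 2 1 2 2 1 (q ^ 3) (q ^ 3) (q ^ 3) q (r, s, t) := by
  simp only [heckeTripleTerm, ← zpow_natCast, ← zpow_mul]
  rw [neg_one_zpow_eq_of_odd (m := -1 - r + (-1 - s) + (-1 - t)) (n := r + s + t) ⟨-2, by ring⟩,
    neg_mul, neg_mul, neg_mul, neg_mul, neg_inj]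
  simp only [mul_assoc, ← zpow_add₀ hq0]
  rw [intChooseTwo_neg_one_sub, intChooseTwo_neg_one_sub, intChooseTwo_neg_one_sub]
  congr 2
  push_cast
  ring

/-- The reflection n ↦ 1 - 2k - n preserves the exponent of q and reverses the parity of n, so the
terms cancel in pairs. -/
theorem tsum_thetaTerm_zpow (k : ℤ) : ∑' n, thetaTerm (q ^ k) q n = 0 := by
  rw [← self_eq_neg, ← tsum_neg, ← (Equiv.subLeft (1 - 2 * k)).tsum_eq]
  refine tsum_congr fun n => ?_
  simp only [thetaTerm, Equiv.subLeft_apply, ← zpow_mul]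
  rw [neg_one_zpow_eq_of_odd (m := 1 - 2 * k - n) (n := n) ⟨-k, by ring⟩, neg_mul, neg_mul,
    neg_inj, mul_assoc, mul_assoc, ← zpow_add₀ hq0, ← zpow_add₀ hq0]
  have h := two_mul_intChooseTwo n
  have h' := two_mul_intChooseTwo (1 - 2 * k - n)
  congr 2
  linarith

theorem heckeDouble_sq_sq : heckeDouble (q ^ 2) (q ^ 2) q = 0 := by
  have h := heckeDouble_zpow_reflect hq0 2 2
  norm_num at h
  exact_mod_cast self_eq_neg.1 h

variable (hq1 : ‖q‖ < 1)
include hq1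

theorem heckeTriple_rotate {x y z : ℂ} (hx : x ≠ 0) (hy : y ≠ 0) (hz : z ≠ 0) :
    heckeTriple 1 2 1 2 2 1 x y z q = heckeTriple 1 2 1 2 2 1 z x y q := by
  let e : ℤ × ℤ × ℤ ≃ ℤ × ℤ × ℤ := (Equiv.prodComm ℤ (ℤ × ℤ)).trans (Equiv.prodAssoc ℤ ℤ ℤ)
  rw [heckeTriple_eq_tsum hq0 hq1 hx hy hz, heckeTriple_eq_tsum hq0 hq1 hz hx hy, ← e.tsum_eq]
  refine tsum_congr fun ⟨r, s, t⟩ => ?_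
  have h : octantInd s t r = octantInd r s t := by
    unfold octantInd
    split_ifs <;> first | omega | rfl
  change octantInd s t r * heckeTripleTerm 1 2 1 2 2 1 x y z q (s, t, r) = _
  simp only [h, heckeTripleTerm]
  rw [show s + t + r = r + s + t by ring,
    show 1 * intChooseTwo s + 2 * s * t + 1 * intChooseTwo t + 2 * s * r + 2 * t * r +
      1 * intChooseTwo r = 1 * intChooseTwo r + 2 * r * s + 1 * intChooseTwo s + 2 * r * t +
      2 * s * t + 1 * intChooseTwo t by ring]
  ring

theorem heckeTriple_cube : heckeTriple 1 2 1 2 2 1 (q ^ 3) (q ^ 3) (q ^ 3) q = 0 := by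
  have h3 : q ^ 3 ≠ 0 := pow_ne_zero 3 hq0
  let e : ℤ ≃ ℤ := Equiv.subLeft (-1)
  rw [heckeTriple_eq_tsum hq0 hq1 h3 h3 h3, ← self_eq_neg, ← tsum_neg,
    ← (e.prodCongr (e.prodCongr e)).tsum_eq]
  refine tsum_congr fun ⟨r, s, t⟩ => ?_
  change octantInd (-1 - r) (-1 - s) (-1 - t) * heckeTripleTerm 1 2 1 2 2 1 (q ^ 3) (q ^ 3) (q ^ 3)
    q (-1 - r, -1 - s, -1 - t) = _
  rw [octantInd_neg_one_sub, heckeTriple_cube_term_reflect hq0, mul_neg]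

/-- The functional equation at (q, q) has vanishing theta term and leads to (q², q³), which
reflection sends to (q², q). -/
theorem heckeDouble_self_sq : heckeDouble q (q ^ 2) q = heckeDouble q q q := by
  have h := heckeDouble_zpow_reflect hq0 2 3
  have h' := heckeDouble_functional_eq hq0 hq1 hq0 hq0
  have ht := tsum_thetaTerm_zpow hq0 1
  rw [zpow_one] at ht
  rw [ht, add_zero, ← pow_two, ← pow_succ] at h'
  norm_num at h
  rw [h', h, heckeDouble_comm]
  field_simp

theorem heckeTriple_self_self_sq :
    heckeTriple 1 2 1 2 2 1 q q (q ^ 2) q = heckeDouble q q q := by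
  have h2 : q ^ 2 ≠ 0 := pow_ne_zero 2 hq0
  rw [heckeTriple_rotate hq0 hq1 hq0 hq0 h2, heckeTriple_functional_eq hq0 hq1 h2 hq0 hq0,
    ← pow_succ, ← pow_succ', heckeTriple_cube hq0 hq1, mul_zero, zero_add]

/-- Both triple sums, rotated suitably, are carried by the functional equation to a multiple of the
same value at (q³, q³, q⁴) up to rotation, which is then eliminated. -/
theorem heckeTriple_self_self_cube :
    heckeTriple 1 2 1 2 2 1 q q (q ^ 3) q =
      q * heckeTriple 1 2 1 2 2 1 q (q ^ 2) (q ^ 2) q + (1 - q) * heckeDouble q q q := by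
  have h2 : q ^ 2 ≠ 0 := pow_ne_zero 2 hq0
  have h3 : q ^ 3 ≠ 0 := pow_ne_zero 3 hq0
  have h4 : q ^ 4 ≠ 0 := pow_ne_zero 4 hq0
  rw [heckeTriple_rotate hq0 hq1 hq0 hq0 h3, heckeTriple_functional_eq hq0 hq1 h3 hq0 hq0,
    heckeTriple_rotate hq0 hq1 hq0 h2 h2, heckeTriple_functional_eq hq0 hq1 h2 hq0 h2,
    ← pow_succ, ← pow_succ', ← pow_succ', ← pow_add, heckeTriple_rotate hq0 hq1 h3 h3 h4,
    heckeDouble_self_sq hq0 hq1]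
  ring

/-- Here the common value eliminated is the one at (q³, q⁴, q⁴), and the double sum at (q², q²)
drops out by reflection. -/
theorem heckeTriple_self_sq_cube :
    heckeTriple 1 2 1 2 2 1 q (q ^ 2) (q ^ 3) q =
      q * heckeTriple 1 2 1 2 2 1 (q ^ 2) (q ^ 2) (q ^ 2) q + heckeDouble q q q := by
  have h2 : q ^ 2 ≠ 0 := pow_ne_zero 2 hq0
  have h3 : q ^ 3 ≠ 0 := pow_ne_zero 3 hq0
  have h4 : q ^ 4 ≠ 0 := pow_ne_zero 4 hq0
  rw [heckeTriple_rotate hq0 hq1 hq0 h2 h3, heckeTriple_functional_eq hq0 hq1 h3 hq0 h2,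
    heckeTriple_functional_eq hq0 hq1 h2 h2 h2, heckeDouble_sq_sq hq0,
    ← pow_succ, ← pow_succ', ← pow_succ', ← pow_add, heckeTriple_rotate hq0 hq1 h3 h4 h4,
    heckeDouble_self_sq hq0 hq1]
  ring

end Symmetry

/-! ### Reciprocals of `q`-factorials -/

/-- `1 / (q; q)_k`, extended by zero to negative integers `k`. -/
def invPoch (q : ℂ) (k : ℤ) : ℂ := if 0 ≤ k then (qPoch q q k.toNat)⁻¹ else 0

theorem qPoch_self_succ (q : ℂ) (n : ℕ) :
    qPoch q q (n + 1) = qPoch q q n * (1 - q ^ (n + 1)) := by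
  rw [qPoch, qPoch, Finset.prod_range_succ, pow_succ]

@[simp] theorem invPoch_natCast (q : ℂ) (n : ℕ) : invPoch q n = (qPoch q q n)⁻¹ := by
  simp [invPoch]

theorem invPoch_of_neg (q : ℂ) {k : ℤ} (hk : k < 0) : invPoch q k = 0 := by
  rw [invPoch, if_neg (by omega)]

@[simp] theorem invPoch_zero (q : ℂ) : invPoch q 0 = 1 := by simp [invPoch, qPoch]

theorem one_sub_pow_ne_zero {q : ℂ} (hq1 : ‖q‖ < 1) {n : ℕ} (hn : n ≠ 0) : 1 - q ^ n ≠ 0 := by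
  intro h
  have h1 : ‖q ^ n‖ = 1 := by rw [← sub_eq_zero.1 h, norm_one]
  rw [norm_pow] at h1
  exact (pow_lt_one₀ (norm_nonneg q) hq1 hn).ne h1

theorem qPoch_self_ne_zero {q : ℂ} (hq1 : ‖q‖ < 1) (n : ℕ) : qPoch q q n ≠ 0 := by
  rw [qPoch, Finset.prod_ne_zero_iff]
  intro i _
  rw [← pow_succ]
  exact one_sub_pow_ne_zero hq1 (Nat.succ_ne_zero i)

theorem one_sub_zpow_mul_invPoch {q : ℂ} (hq1 : ‖q‖ < 1) (k : ℤ) :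
    (1 - q ^ k) * invPoch q k = invPoch q (k - 1) := by
  rcases lt_trichotomy k 0 with hk | rfl | hk
  · rw [invPoch_of_neg q hk, invPoch_of_neg q (by omega), mul_zero]
  · rw [invPoch_of_neg q (k := 0 - 1) (by omega)]
    simp
  · obtain ⟨n, rfl⟩ : ∃ n : ℕ, k = (n + 1 : ℕ) := ⟨(k - 1).toNat, by omega⟩
    rw [show ((n + 1 : ℕ) : ℤ) - 1 = n by push_cast; ring, zpow_natCast, invPoch_natCast,
      invPoch_natCast, qPoch_self_succ]
    have := one_sub_pow_ne_zero hq1 (Nat.succ_ne_zero n)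
    have := qPoch_self_ne_zero hq1 n
    field_simp

theorem eulerJ_one (q : ℂ) : eulerJ 1 q = ∏' i : ℕ, (1 - q ^ (i + 1)) := by
  simp [eulerJ]

theorem eulerJ_one_ne_zero {q : ℂ} (hq1 : ‖q‖ < 1) : eulerJ 1 q ≠ 0 := by
  rw [eulerJ_one]
  have h := tprod_one_add_ne_zero_of_summable (f := fun i : ℕ => -q ^ (i + 1))
    (fun i => by
      rw [← sub_eq_add_neg]
      exact one_sub_pow_ne_zero hq1 (Nat.succ_ne_zero i)) (by
      simp only [norm_neg, norm_pow]
      exact (summable_nat_add_iff 1).2 (summable_geometric_of_lt_one (norm_nonneg q) hq1))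
  simpa only [← sub_eq_add_neg] using h

theorem tendsto_qPoch_self {q : ℂ} (hq1 : ‖q‖ < 1) :
    Tendsto (qPoch q q) atTop (𝓝 (eulerJ 1 q)) := by
  rw [eulerJ_one]
  refine (ModularForm.multipliable_one_sub_pow hq1).tendsto_prod_tprod_nat.congr fun n => ?_
  simp only [qPoch, pow_succ]

theorem tendsto_invPoch {q : ℂ} (hq1 : ‖q‖ < 1) :
    Tendsto (invPoch q) atTop (𝓝 (eulerJ 1 q)⁻¹) := by
  have h := ((tendsto_qPoch_self hq1).inv₀ (eulerJ_one_ne_zero hq1)).comp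
    (tendsto_atTop_atTop.2 fun n => ⟨n, fun k hk => by omega⟩ : Tendsto Int.toNat atTop atTop)
  refine h.congr' ?_
  filter_upwards [eventually_ge_atTop 0] with k hk
  simp [invPoch, hk]

theorem exists_norm_invPoch_le {q : ℂ} (hq1 : ‖q‖ < 1) :
    ∃ C, 0 ≤ C ∧ ∀ k, ‖invPoch q k‖ ≤ C := by
  have h := ((tendsto_qPoch_self hq1).inv₀ (eulerJ_one_ne_zero hq1)).norm.bddAbove_range
  obtain ⟨C, hC⟩ := h
  have hC' : ∀ n, ‖(qPoch q q n)⁻¹‖ ≤ C := fun n => hC ⟨n, rfl⟩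
  have h0 : 0 ≤ C := (norm_nonneg _).trans (hC' 0)
  refine ⟨C, h0, fun k => ?_⟩
  rw [invPoch]
  split_ifs
  · exact hC' _
  · simpa using h0

/-! ### Sums against `1 / ((q; q)_{a - N} (q; q)_{b + N})` -/

/-- Since `invPoch` vanishes at negative integers, the sum is finite and no growth condition on g is
needed. -/
theorem summable_mul_invPoch (q : ℂ) (a b : ℤ) (g : ℤ → ℂ) :
    Summable fun N => g N * (invPoch q (a - N) * invPoch q (b + N)) := by
  refine summable_of_ne_finset_zero (s := Finset.Icc (-b) a) fun N hN => ?_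
  rw [Finset.mem_Icc, not_and_or] at hN
  rcases hN with h | h
  · rw [invPoch_of_neg q (k := b + N) (by omega), mul_zero, mul_zero]
  · rw [invPoch_of_neg q (k := a - N) (by omega), zero_mul, mul_zero]

/-- The functional `g ↦ ∑_N g(N) / ((q; q)_{a - N} (q; q)_{b + N})`. -/
def binomSum (q : ℂ) (a b : ℤ) : (ℤ → ℂ) →ₗ[ℂ] ℂ where
  toFun g := ∑' N, g N * (invPoch q (a - N) * invPoch q (b + N))
  map_add' g h := by
    rw [← (summable_mul_invPoch q a b g).tsum_add (summable_mul_invPoch q a b h)]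
    exact tsum_congr fun N => add_mul _ _ _
  map_smul' c g := by
    rw [RingHom.id_apply, smul_eq_mul, ← tsum_mul_left]
    exact tsum_congr fun N => mul_assoc _ _ _

theorem binomSum_apply (q : ℂ) (a b : ℤ) (g : ℤ → ℂ) :
    binomSum q a b g = ∑' N, g N * (invPoch q (a - N) * invPoch q (b + N)) := rfl

theorem binomSum_shift (q : ℂ) (a b k : ℤ) (g : ℤ → ℂ) :
    binomSum q a b g = binomSum q (a - k) (b + k) fun N => g (N + k) := by
  rw [binomSum_apply, binomSum_apply, ← (Equiv.addRight k).tsum_eq]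
  refine tsum_congr fun N => ?_
  rw [Equiv.coe_addRight, show a - (N + k) = a - k - N by ring,
    show b + (N + k) = b + k + N by ring]

theorem binomSum_reflect (q : ℂ) (a b : ℤ) (g : ℤ → ℂ) :
    binomSum q a b g = binomSum q b a fun N => g (-N) := by
  rw [binomSum_apply, binomSum_apply, ← (Equiv.neg ℤ).tsum_eq]
  refine tsum_congr fun N => ?_
  rw [Equiv.neg_apply, sub_neg_eq_add, ← sub_eq_add_neg, mul_comm (invPoch q (a + N))]

/-- The coefficients `(-1)^N q^{N(N-1)/2 + kN}`. -/
def thetaCoeff (q : ℂ) (k N : ℤ) : ℂ := (-1) ^ N * q ^ (intChooseTwo N + k * N)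

/-- The sum of `quadrantSign r s * heckeDoubleTerm q q q r s` over a line `r + s = N`. -/
def heckeDiag (q : ℂ) (N : ℤ) : ℂ :=
  ∑' r, quadrantSign r (N - r) * heckeDoubleTerm q q q r (N - r)

/-! ### Contiguous relations and vanishing theta moments -/

section FiniteIdentity

variable {q : ℂ} (hq1 : ‖q‖ < 1)
include hq1

theorem binomSum_pred_left (a b : ℤ) (g : ℤ → ℂ) :
    binomSum q (a - 1) b g = binomSum q a b fun N => g N * (1 - q ^ (a - N)) := by
  rw [binomSum_apply, binomSum_apply]
  refine tsum_congr fun N => ?_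
  rw [show a - 1 - N = a - N - 1 by ring, ← one_sub_zpow_mul_invPoch hq1]
  ring

theorem binomSum_pred_right (a b : ℤ) (g : ℤ → ℂ) :
    binomSum q a (b - 1) g = binomSum q a b fun N => g N * (1 - q ^ (b + N)) := by
  rw [binomSum_apply, binomSum_apply]
  refine tsum_congr fun N => ?_
  rw [show b - 1 + N = b + N - 1 by ring, ← one_sub_zpow_mul_invPoch hq1]
  ring

/-- Both sides equal the functional with parameters (a, b-1): lowering b and then shifting N by one
amounts to lowering a. -/
theorem binomSum_telescope (a b : ℤ) (g : ℤ → ℂ) :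
    binomSum q a b (fun N => g N * (1 - q ^ (b + N))) =
      binomSum q a b (fun N => g (N + 1) * (1 - q ^ (a - N))) := by
  rw [← binomSum_pred_right hq1, ← binomSum_pred_left hq1 a b fun N => g (N + 1),
    binomSum_shift q a (b - 1) 1, sub_add_cancel]

variable (hq0 : q ≠ 0)
include hq0

/-- Reflection identifies the moments with k = 0 and k = 1, while telescoping says that 1 - q^n
times their sum vanishes. -/
theorem binomSum_thetaCoeff_zero {n : ℤ} (hn : 1 - q ^ n ≠ 0) :
    binomSum q n n (thetaCoeff q 0) = 0 := by
  have h := binomSum_telescope hq1 n n (thetaCoeff q 0)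
  have h1 : binomSum q n n (thetaCoeff q 0) = binomSum q n n (thetaCoeff q 1) := by
    rw [binomSum_reflect]
    congr 1
    funext N
    rw [thetaCoeff, thetaCoeff, neg_one_zpow_eq_of_even (m := -N) (n := N) ⟨0, by ring⟩,
      intChooseTwo_neg]
    congr 2
    ring
  rw [← sub_eq_zero, ← map_sub] at h
  have h2 : ((fun N => thetaCoeff q 0 N * (1 - q ^ (n + N))) -
      fun N => thetaCoeff q 0 (N + 1) * (1 - q ^ (n - N))) =
      (1 - q ^ n) • (thetaCoeff q 0 + thetaCoeff q 1) := by
    funext N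
    simp only [Pi.sub_apply, Pi.smul_apply, Pi.add_apply, smul_eq_mul, thetaCoeff, zero_mul,
      add_zero, one_mul]
    rw [intChooseTwo_add_one, zpow_add_one₀ (by norm_num), zpow_add₀ hq0, zpow_add₀ hq0,
      zpow_sub₀ hq0]
    have := zpow_ne_zero N hq0
    field_simp
    ring
  rw [h2, map_smul, map_add, ← h1, smul_eq_mul, mul_eq_zero] at h
  exact add_self_eq_zero.1 (h.resolve_left hn)

theorem binomSum_thetaCoeff_neg_one {n : ℤ} (hn : 1 - q ^ n ≠ 0) (hn' : 1 - q ^ (n - 1) ≠ 0) :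
    binomSum q n n (thetaCoeff q (-1)) = 0 := by
  have h := binomSum_telescope hq1 n n (thetaCoeff q (-1))
  have h1 := binomSum_thetaCoeff_zero hq1 hq0 hn
  rw [← sub_eq_zero, ← map_sub] at h
  have h2 : ((fun N => thetaCoeff q (-1) N * (1 - q ^ (n + N))) -
      fun N => thetaCoeff q (-1) (N + 1) * (1 - q ^ (n - N))) =
      (1 - q ^ (n - 1)) • thetaCoeff q (-1) + (q⁻¹ - q ^ n) • thetaCoeff q 0 := by
    funext N
    simp only [Pi.sub_apply, Pi.smul_apply, Pi.add_apply, smul_eq_mul, thetaCoeff, zero_mul,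
      add_zero]
    rw [show intChooseTwo (N + 1) + -1 * (N + 1) = intChooseTwo N - 1 by
        rw [intChooseTwo_add_one]; ring,
      show intChooseTwo N + -1 * N = intChooseTwo N - N by ring,
      zpow_add_one₀ (by norm_num), zpow_add₀ hq0, zpow_sub_one₀ hq0, zpow_sub_one₀ hq0,
      zpow_sub₀ hq0, zpow_sub₀ hq0]
    have := zpow_ne_zero N hq0
    field_simp
    ring
  rw [h2, map_add, map_smul, map_smul, h1, smul_zero, add_zero, smul_eq_mul, mul_eq_zero] at h
  exact h.resolve_left hn'

end FiniteIdentity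

/-! ### Diagonal sums of the double series and their finite moments -/

theorem heckeDoubleTerm_diag {q : ℂ} (hq0 : q ≠ 0) (N r : ℤ) :
    heckeDoubleTerm q q q r (N - r) = thetaCoeff q 1 N * q ^ (r * (N - r)) := by
  have h := intChooseTwo_add r (N - r)
  rw [add_sub_cancel] at h
  rw [heckeDoubleTerm, thetaCoeff, add_sub_cancel, h]
  simp only [mul_assoc, ← zpow_add₀ hq0]
  congr 2
  ring

theorem heckeDiag_neg_two_sub {q : ℂ} (hq0 : q ≠ 0) (N : ℤ) :
    heckeDiag q (-2 - N) = -q ^ (2 * N + 2) * heckeDiag q N := by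
  rw [heckeDiag, heckeDiag, ← tsum_mul_left, ← (Equiv.subLeft (-1 : ℤ)).tsum_eq]
  refine tsum_congr fun r => ?_
  rw [Equiv.subLeft_apply, show -2 - N - (-1 - r) = -1 - (N - r) by ring, quadrantSign_neg_one_sub,
    neg_mul, neg_mul, neg_inj, mul_left_comm]
  congr 1
  rw [show -1 - (N - r) = -2 - N - (-1 - r) by ring, heckeDoubleTerm_diag hq0,
    heckeDoubleTerm_diag hq0, thetaCoeff, thetaCoeff, mul_assoc, mul_assoc,
    mul_left_comm (q ^ (2 * N + 2)),
    neg_one_zpow_eq_of_even (m := -2 - N) (n := N) ⟨-1, by ring⟩]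
  congr 1
  have h := two_mul_intChooseTwo N
  have h' := two_mul_intChooseTwo (-2 - N)
  simp only [← zpow_add₀ hq0]
  congr 1
  linarith

theorem heckeDiag_neg_one {q : ℂ} (hq0 : q ≠ 0) : heckeDiag q (-1) = 0 := by
  have h := heckeDiag_neg_two_sub hq0 (-1)
  norm_num at h
  exact self_eq_neg.1 h

section HeckeDiag

variable {q : ℂ} (hq1 : ‖q‖ < 1) (hq0 : q ≠ 0)
include hq1 hq0

theorem summable_heckeDiag (N : ℤ) :
    Summable fun r => quadrantSign r (N - r) * heckeDoubleTerm q q q r (N - r) :=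
  (summable_heckeDouble hq0 hq1 hq0 hq0).comp_injective
    (i := fun r : ℤ => (r, N - r)) fun _ _ h => congrArg Prod.fst h

/-- Moving (r, s) to (r-1, s-1) changes the summand only through the quadrant sign, leaving the
boundary contributions r = 0 and s = 0. They are equal, and both sit at r = 0 when N = 0. -/
theorem heckeDiag_eq (N : ℤ) :
    heckeDiag q N = q ^ (3 * N - 2) * heckeDiag q (N - 2) + 2 * thetaCoeff q 1 N := by
  have hs := summable_heckeDiag hq1 hq0 N
  have hs' := ((Equiv.subRight (1 : ℤ)).summable_iff.2
    (summable_heckeDiag hq1 hq0 (N - 2))).mul_left (q ^ (3 * N - 2))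
  have hterm : ∀ r, quadrantSign r (N - r) * heckeDoubleTerm q q q r (N - r) -
      q ^ (3 * N - 2) * (quadrantSign (r - 1) (N - 2 - (r - 1)) *
        heckeDoubleTerm q q q (r - 1) (N - 2 - (r - 1))) =
      (if r = 0 then thetaCoeff q 1 N else 0) + if r = N then thetaCoeff q 1 N else 0 := by
    intro r
    have h := quadrantSign_sub_one_sub_one r (N - r)
    have h' : q ^ (3 * N - 2) * (thetaCoeff q 1 (N - 2) * q ^ ((r - 1) * (N - 2 - (r - 1)))) =
        thetaCoeff q 1 N * q ^ (r * (N - r)) := by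
      have h1 := two_mul_intChooseTwo N
      have h2 := two_mul_intChooseTwo (N - 2)
      rw [thetaCoeff, thetaCoeff, neg_one_zpow_eq_of_even (m := N - 2) (n := N) ⟨N - 1, by ring⟩,
        mul_assoc, mul_assoc, mul_left_comm]
      simp only [← zpow_add₀ hq0]
      congr 2
      linarith
    rw [mul_left_comm, heckeDoubleTerm_diag hq0, heckeDoubleTerm_diag hq0, h',
      show N - 2 - (r - 1) = N - r - 1 by ring, ← sub_mul, h, add_mul]
    congr 1
    · split_ifs with hr
      · simp [hr]
      · exact zero_mul _
    · split_ifs with hr hr' hr'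
      · simp [hr]
      · omega
      · omega
      · exact zero_mul _
  rw [← sub_eq_iff_eq_add', heckeDiag, heckeDiag, ← tsum_mul_left,
    ← (Equiv.subRight (1 : ℤ)).tsum_eq (fun r => q ^ (3 * N - 2) * (quadrantSign r (N - 2 - r) *
      heckeDoubleTerm q q q r (N - 2 - r)))]
  refine (hs.tsum_sub hs').symm.trans ((tsum_congr hterm).trans ?_)
  rw [Summable.tsum_add (hasSum_ite_eq _ _).summable (hasSum_ite_eq _ _).summable, tsum_ite_eq,
    tsum_ite_eq, two_mul]

/-- The reflection N ↦ -2-N combined with the two-step recurrence gives N ↦ -N at the cost of a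
theta coefficient, which the moments above annihilate. -/
theorem heckeDiag_neg (N : ℤ) :
    heckeDiag q (-N) = -q ^ (-N) * (heckeDiag q N - 2 * thetaCoeff q 1 N) := by
  have h := heckeDiag_neg_two_sub hq0 (N - 2)
  rw [heckeDiag_eq hq1 hq0 N, add_sub_cancel_right, show -N = -2 - (N - 2) by ring, h,
    neg_mul, neg_mul, neg_inj, ← mul_assoc, ← zpow_add₀ hq0]
  congr 2
  ring

theorem heckeDiag_zero : heckeDiag q 0 = 1 := by
  have h := heckeDiag_neg hq1 hq0 0
  simp [thetaCoeff] at h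
  linear_combination h / 2

theorem heckeDiag_one : heckeDiag q 1 = -2 * q := by
  have h := heckeDiag_eq hq1 hq0 1
  norm_num [heckeDiag_neg_one hq0, thetaCoeff, show intChooseTwo 1 = 0 from rfl] at h
  rw [h, neg_mul]

theorem binomSum_heckeDiag_one {n : ℤ} (hn : 1 - q ^ n ≠ 0) (hn' : 1 - q ^ (n - 1) ≠ 0) :
    binomSum q n n (fun N => heckeDiag q N * q ^ N) =
      -binomSum q n n (fun N => heckeDiag q N * q ^ (-2 * N)) := by
  have h : (fun N => heckeDiag q (-N) * q ^ (-N)) =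
      (2 : ℂ) • thetaCoeff q (-1) - fun N => heckeDiag q N * q ^ (-2 * N) := by
    funext N
    simp only [Pi.sub_apply, Pi.smul_apply, smul_eq_mul, thetaCoeff]
    rw [heckeDiag_neg hq1 hq0, thetaCoeff, show -2 * N = -N + -N by ring, zpow_add₀ hq0 (-N),
      show intChooseTwo N + -1 * N = intChooseTwo N + 1 * N + (-N + -N) by ring,
      zpow_add₀ hq0 _ (-N + -N), zpow_add₀ hq0 (-N)]
    ring
  rw [binomSum_reflect, h, map_sub, map_smul, binomSum_thetaCoeff_neg_one hq1 hq0 hn hn',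
    smul_zero, zero_sub]

theorem binomSum_heckeDiag_zero {n : ℤ} (hn : 1 - q ^ n ≠ 0) :
    binomSum q n n (heckeDiag q) = -binomSum q n n (fun N => heckeDiag q N * q ^ (-N)) := by
  have h : (fun N => heckeDiag q (-N)) =
      (2 : ℂ) • thetaCoeff q 0 - fun N => heckeDiag q N * q ^ (-N) := by
    funext N
    simp only [Pi.sub_apply, Pi.smul_apply, smul_eq_mul, thetaCoeff]
    rw [heckeDiag_neg hq1 hq0, thetaCoeff,
      show intChooseTwo N + 0 * N = intChooseTwo N + 1 * N + (-N) by ring, zpow_add₀ hq0 _ (-N)]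
    ring
  rw [binomSum_reflect, h, map_sub, map_smul, binomSum_thetaCoeff_zero hq1 hq0 hn, smul_zero,
    zero_sub]

/-- The two-step recurrence followed by a shift of N by 2 exchanges the parameters n and n - 2. The
theta remainder vanishes after recentring by a shift of 1. -/
theorem binomSum_heckeDiag_sub_two {n : ℤ} (hn' : 1 - q ^ (n - 1) ≠ 0) :
    binomSum q n (n - 2) (fun N => heckeDiag q N * q ^ (-2 * N)) =
      binomSum q (n - 2) n (fun N => heckeDiag q N * q ^ N) := by
  have h : (fun N => heckeDiag q N * q ^ (-2 * N)) =
      (fun N => q ^ (3 * N - 2) * heckeDiag q (N - 2) * q ^ (-2 * N)) +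
        (2 : ℂ) • thetaCoeff q (-1) := by
    funext N
    simp only [Pi.add_apply, Pi.smul_apply, smul_eq_mul]
    rw [heckeDiag_eq hq1 hq0, thetaCoeff, thetaCoeff,
      show intChooseTwo N + -1 * N = intChooseTwo N + 1 * N + (-2 * N) by ring,
      zpow_add₀ hq0 _ (-2 * N)]
    ring
  have h1 : binomSum q n (n - 2) (thetaCoeff q (-1)) = 0 := by
    rw [binomSum_shift q n (n - 2) 1, show n - 2 + 1 = n - 1 by ring,
      show (fun N => thetaCoeff q (-1) (N + 1)) = (-q⁻¹) • thetaCoeff q 0 from ?_, map_smul,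
      binomSum_thetaCoeff_zero hq1 hq0 hn', smul_zero]
    funext N
    simp only [Pi.smul_apply, smul_eq_mul, thetaCoeff]
    rw [intChooseTwo_add_one, zpow_add_one₀ (by norm_num),
      show intChooseTwo N + N + -1 * (N + 1) = intChooseTwo N + 0 * N - 1 by ring,
      zpow_sub_one₀ hq0]
    ring
  rw [h, map_add, map_smul, h1, smul_zero, add_zero, binomSum_shift q n (n - 2) 2, sub_add_cancel]
  congr 1
  funext N
  rw [add_sub_cancel_right, mul_comm (q ^ _), mul_assoc, ← zpow_add₀ hq0]
  congr 2
  ring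

/-- Let a_k be the moment of `heckeDiag` against q^{kN}. Reflection gives a_1 = -a_{-2} and a_0 =
-a_{-1}; the relation between the parameters (n, n-2) and (n-2, n) supplies one more equation, which
expresses a_1 through a_0. The left side is a combination of a_{-1}, a_0 and a_1. -/
theorem binomSum_heckeDiag_recurrence {n : ℤ} (hn : 1 - q ^ n ≠ 0) (hn' : 1 - q ^ (n - 1) ≠ 0) :
    binomSum q (n - 1) (n - 1) (heckeDiag q) =
      (1 + q ^ n) * (1 - q ^ (2 * n - 1)) * binomSum q n n (heckeDiag q) := by
  have h1 := binomSum_heckeDiag_one hq1 hq0 hn hn'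
  have h0 := binomSum_heckeDiag_zero hq1 hq0 hn
  have h := binomSum_heckeDiag_sub_two hq1 hq0 hn'
  rw [show n - 2 = n - 1 - 1 by ring, binomSum_pred_right hq1, binomSum_pred_right hq1,
    binomSum_pred_left hq1, binomSum_pred_left hq1, ← sub_eq_zero, ← map_sub] at h
  have e1 : ((fun N => heckeDiag q N * q ^ (-2 * N) * (1 - q ^ (n - 1 + N)) * (1 - q ^ (n + N))) -
      fun N => heckeDiag q N * q ^ N * (1 - q ^ (n - 1 - N)) * (1 - q ^ (n - N))) =
      (fun N => heckeDiag q N * q ^ (-2 * N)) -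
      (q ^ n + q ^ (n - 1) + q ^ (2 * n - 1)) • (fun N => heckeDiag q N * q ^ (-N)) -
      (fun N => heckeDiag q N * q ^ N) +
      (q ^ n + q ^ (n - 1) + q ^ (2 * n - 1)) • heckeDiag q := by
    funext N
    simp only [Pi.sub_apply, Pi.smul_apply, Pi.add_apply, smul_eq_mul]
    rw [show -2 * N = -N + -N by ring, show 2 * n - 1 = n + (n - 1) by ring]
    simp only [zpow_add₀ hq0, zpow_sub₀ hq0, zpow_neg, zpow_one]
    have := zpow_ne_zero N hq0
    field_simp
    ring
  have e2 : (fun N => heckeDiag q N * (1 - q ^ (n - N)) * (1 - q ^ (n + N))) =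
      (1 + q ^ (2 * n)) • heckeDiag q - q ^ n • (fun N => heckeDiag q N * q ^ N) -
        q ^ n • (fun N => heckeDiag q N * q ^ (-N)) := by
    funext N
    simp only [Pi.sub_apply, Pi.smul_apply, smul_eq_mul]
    rw [show 2 * n = n + n by ring]
    simp only [zpow_add₀ hq0, zpow_sub₀ hq0, zpow_neg]
    have := zpow_ne_zero N hq0
    field_simp
    ring
  have e4 : q ^ n * q ^ (n - 1) = q ^ (2 * n - 1) := by
    rw [← zpow_add₀ hq0]
    congr 1
    ring
  have e5 : q ^ n * q ^ n = q ^ (2 * n) := by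
    rw [← zpow_add₀ hq0]
    congr 1
    ring
  rw [e1, map_add, map_sub, map_sub, map_smul, map_smul, smul_eq_mul, smul_eq_mul] at h
  rw [binomSum_pred_left hq1, binomSum_pred_right hq1]
  rw [e2, map_sub, map_sub, map_smul, map_smul, map_smul, smul_eq_mul, smul_eq_mul, smul_eq_mul]
  generalize binomSum q n n (fun N => heckeDiag q N * q ^ N) = a1 at *
  generalize binomSum q n n (fun N => heckeDiag q N * q ^ (-N)) = am1 at *
  generalize binomSum q n n (fun N => heckeDiag q N * q ^ (-2 * N)) = am2 at *
  generalize binomSum q n n (heckeDiag q) = a0 at *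
  obtain rfl : am2 = -a1 := by linear_combination h1
  obtain rfl : am1 = -a0 := by linear_combination h0
  have h2 : a1 = (q ^ n + q ^ (n - 1) + q ^ (2 * n - 1)) * a0 := by linear_combination -h / 2
  rw [h2]
  linear_combination (-e4 - e5) * a0

end HeckeDiag

/-! ### Closed forms of the finite sums and their limit -/

section Evaluation

variable {q : ℂ} (hq1 : ‖q‖ < 1) (hq0 : q ≠ 0)
include hq1 hq0

theorem binomSum_heckeDiag_eq (n : ℕ) :
    binomSum q n n (heckeDiag q) = qPoch q q n / qPoch q q (2 * n) := by
  have h1 : 1 - q ≠ 0 := by simpa using one_sub_pow_ne_zero hq1 one_ne_zero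
  have h2 : 1 - q ^ 2 ≠ 0 := one_sub_pow_ne_zero hq1 two_ne_zero
  rcases n with _ | n
  · rw [binomSum_apply, tsum_eq_single 0]
    · simp [heckeDiag_zero hq1 hq0, qPoch]
    · intro N hN
      rcases lt_or_gt_of_ne hN with h | h
      · rw [invPoch_of_neg q (k := ((0 : ℕ) : ℤ) + N) (by simpa using h), mul_zero, mul_zero]
      · rw [invPoch_of_neg q (k := ((0 : ℕ) : ℤ) - N) (by simpa using h), zero_mul, mul_zero]
  -- The recurrence leading to n requires q^{n-1} ≠ 1 and so fails at n = 1; that case is computed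
  -- directly.
  · induction n with
    | zero =>
      have e1 : invPoch q 1 = (1 - q)⁻¹ := by simpa [qPoch] using invPoch_natCast q 1
      have e2 : invPoch q 2 = ((1 - q) * (1 - q ^ 2))⁻¹ := by
        simpa [qPoch, Finset.prod_range_succ, pow_two] using invPoch_natCast q 2
      rw [binomSum_apply, tsum_eq_sum (s := {-1, 0, 1})]
      · rw [Finset.sum_insert (by decide), Finset.sum_insert (by decide), Finset.sum_singleton,
          heckeDiag_neg_one hq0, heckeDiag_zero hq1 hq0, heckeDiag_one hq1 hq0]
        norm_num [qPoch_self_succ, e1, e2, show qPoch q q 0 = 1 from rfl]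
        field_simp
        ring
      · intro N hN
        simp only [Finset.mem_insert, Finset.mem_singleton, not_or] at hN
        rcases lt_or_gt_of_ne hN.2.1 with h | h
        · rw [invPoch_of_neg q (k := ((0 + 1 : ℕ) : ℤ) + N) (by push_cast; omega), mul_zero,
            mul_zero]
        · rw [invPoch_of_neg q (k := ((0 + 1 : ℕ) : ℤ) - N) (by push_cast; omega), zero_mul,
            mul_zero]
    | succ n ih =>
      have hn : 1 - q ^ (n + 1 + 1) ≠ 0 := one_sub_pow_ne_zero hq1 (by omega)
      have hn' : 1 - q ^ (n + 1) ≠ 0 := one_sub_pow_ne_zero hq1 (by omega)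
      have ha : 1 - q ^ (2 * (n + 1) + 1) ≠ 0 := one_sub_pow_ne_zero hq1 (by omega)
      have hb : 1 - q ^ (2 * (n + 1) + 1 + 1) ≠ 0 := one_sub_pow_ne_zero hq1 (by omega)
      have hc : 1 - q ^ (2 * (n + 1) + 1 + 1) = (1 - q ^ (n + 1 + 1)) * (1 + q ^ (n + 1 + 1)) := by
        ring
      have hd : 1 + q ^ (n + 1 + 1) ≠ 0 := right_ne_zero_of_mul (hc ▸ hb)
      have h := binomSum_heckeDiag_recurrence hq1 hq0 (n := ((n + 1 + 1 : ℕ) : ℤ))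
        (by rwa [zpow_natCast])
        (by rwa [show ((n + 1 + 1 : ℕ) : ℤ) - 1 = (n + 1 : ℕ) by push_cast; ring, zpow_natCast])
      rw [show ((n + 1 + 1 : ℕ) : ℤ) - 1 = (n + 1 : ℕ) by push_cast; ring, ih, zpow_natCast,
        show 2 * ((n + 1 + 1 : ℕ) : ℤ) - 1 = (2 * (n + 1) + 1 : ℕ) by push_cast; ring,
        zpow_natCast] at h
      rw [show 2 * (n + 1 + 1) = 2 * (n + 1) + 1 + 1 by ring, qPoch_self_succ q (n + 1),
        qPoch_self_succ q (2 * (n + 1) + 1), qPoch_self_succ q (2 * (n + 1)), hc]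
      have hp := qPoch_self_ne_zero hq1 (2 * (n + 1))
      rw [div_eq_iff hp] at h
      rw [eq_div_iff (by simp [hp, ha, hn, hd]), h]
      ring

theorem binomSum_heckeDiag_odd_eq (n : ℕ) :
    binomSum q n (n + 1) (heckeDiag q) = qPoch q q n / qPoch q q (2 * n + 1) := by
  have ha : 1 - q ^ (2 * n + 1) ≠ 0 := one_sub_pow_ne_zero hq1 (by omega)
  have hp := qPoch_self_ne_zero hq1 (2 * n)
  have h := binomSum_heckeDiag_eq hq1 hq0 n
  -- Reflection and a shift by 2 realise N ↦ -2-N and restore the parameters, while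
  -- `heckeDiag_neg_two_sub` makes the summand odd.
  have hz : binomSum q ((n : ℤ) - 1) (n + 1) (fun N => heckeDiag q N * q ^ N) = 0 := by
    rw [← self_eq_neg, ← map_neg, binomSum_reflect, binomSum_shift q _ _ 2,
      show (n : ℤ) + 1 - 2 = n - 1 by ring, show (n : ℤ) - 1 + 2 = n + 1 by ring]
    congr 1
    funext N
    rw [show -(N + 2) = -2 - N by ring, heckeDiag_neg_two_sub hq0, Pi.neg_apply, neg_mul, neg_mul,
      neg_inj, mul_comm (q ^ _), mul_assoc, ← zpow_add₀ hq0]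
    congr 2
    ring
  rw [binomSum_pred_left hq1] at hz
  have h1 := binomSum_pred_right hq1 (n : ℤ) ((n : ℤ) + 1) (heckeDiag q)
  rw [add_sub_cancel_right, h] at h1
  -- Splitting the factor this way isolates the vanishing sum `hz`, leaving only the multiple 1 -
  -- q^{2n+1} of the wanted sum.
  have h2 : (fun N => heckeDiag q N * (1 - q ^ ((n : ℤ) + 1 + N))) =
      (1 - q ^ (2 * n + 1)) • heckeDiag q -
        q ^ (n + 1) • fun N => heckeDiag q N * q ^ N * (1 - q ^ ((n : ℤ) - N)) := by
    funext N
    simp only [Pi.sub_apply, Pi.smul_apply, smul_eq_mul]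
    simp only [zpow_add₀ hq0, zpow_sub₀ hq0, zpow_natCast, zpow_one]
    have := zpow_ne_zero N hq0
    field_simp
    ring
  rw [h2, map_sub, map_smul, map_smul, hz, smul_zero, sub_zero, smul_eq_mul] at h1
  rw [qPoch_self_succ, eq_div_iff (mul_ne_zero hp ha)]
  rw [div_eq_iff hp] at h1
  rw [h1]
  ring

theorem tsum_heckeDiag_mul {φ : ℤ → ℂ} {C : ℝ} (hφ : ∀ N, ‖φ N‖ ≤ C) :
    ∑' p : ℤ × ℤ, quadrantSign p.1 p.2 * heckeDoubleTerm q q q p.1 p.2 * φ (p.1 + p.2) =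
      ∑' N, heckeDiag q N * φ N := by
  let e : ℤ × ℤ ≃ ℤ × ℤ :=
    ⟨fun p => (p.2, p.1 - p.2), fun p => (p.1 + p.2, p.1), fun p => by simp, fun p => by simp⟩
  have hs : Summable fun p : ℤ × ℤ =>
      quadrantSign p.1 p.2 * heckeDoubleTerm q q q p.1 p.2 * φ (p.1 + p.2) := by
    refine Summable.of_norm_bounded ((summable_norm_heckeDouble hq0 hq1 hq0 hq0).mul_right C)
      fun p => ?_
    rw [norm_mul]
    exact mul_le_mul_of_nonneg_left (hφ _) (norm_nonneg _)
  refine (e.tsum_eq _).symm.trans ((e.summable_iff.2 hs).tsum_prod.trans ?_)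
  refine tsum_congr fun N => ?_
  rw [heckeDiag, ← tsum_mul_right]
  refine tsum_congr fun r => ?_
  simp [e]

theorem summable_norm_heckeDiag : Summable fun N => ‖heckeDiag q N‖ := by
  let e : ℤ × ℤ ≃ ℤ × ℤ :=
    ⟨fun p => (p.2, p.1 - p.2), fun p => (p.1 + p.2, p.1), fun p => by simp, fun p => by simp⟩
  have hs := e.summable_iff.2 (summable_norm_heckeDouble hq0 hq1 hq0 hq0)
  refine Summable.of_nonneg_of_le (fun _ => norm_nonneg _) (fun N => ?_) hs.prod
  exact norm_tsum_le_tsum_norm (hs.prod_factor N)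

/-- Let n → ∞ in the finite identity: the weights tend to J⁻² under dominated convergence, while
(q)_n / (q)_{2n} tends to 1. -/
theorem heckeDouble_self_self : heckeDouble q q q = eulerJ 1 q ^ 2 := by
  have hJ := eulerJ_one_ne_zero hq1
  obtain ⟨C, hC0, hC⟩ := exists_norm_invPoch_le hq1
  have h0 : heckeDouble q q q = ∑' N, heckeDiag q N := by
    simpa [heckeDouble] using tsum_heckeDiag_mul hq1 hq0 (φ := fun _ => 1) (C := 1) (by simp)
  have h1 : Tendsto (fun n : ℕ => binomSum q n n (heckeDiag q)) atTop
      (𝓝 (∑' N, heckeDiag q N * ((eulerJ 1 q)⁻¹ * (eulerJ 1 q)⁻¹))) := by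
    simp only [binomSum_apply]
    refine tendsto_tsum_of_dominated_convergence
      ((summable_norm_heckeDiag hq1 hq0).mul_right (C * C)) (fun N => ?_)
      (Eventually.of_forall fun n N => ?_)
    · have hn : Tendsto (fun n : ℕ => (n : ℤ)) atTop atTop := tendsto_natCast_atTop_atTop
      exact (((tendsto_invPoch hq1).comp (tendsto_atTop_add_const_right _ (-N) hn)).mul
        ((tendsto_invPoch hq1).comp (tendsto_atTop_add_const_right _ N hn))).const_mul _
    · rw [norm_mul, norm_mul]
      gcongr
      · exact hC _
      · exact hC _
  have h2 : Tendsto (fun n : ℕ => binomSum q n n (heckeDiag q)) atTop (𝓝 1) := by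
    simp only [binomSum_heckeDiag_eq hq1 hq0]
    rw [← div_self hJ]
    exact (tendsto_qPoch_self hq1).div ((tendsto_qPoch_self hq1).comp
      (tendsto_id.const_mul_atTop' two_pos)) hJ
  have h3 := tendsto_nhds_unique h1 h2
  rw [tsum_mul_right, ← h0] at h3
  field_simp at h3
  exact h3

end Evaluation

theorem octantInd_mul_heckeTripleTerm {q : ℂ} (hq0 : q ≠ 0) (e : ℕ) (r s t : ℤ) :
    octantInd r s t * heckeTripleTerm 1 2 1 2 2 1 (q ^ (e + 1)) (q ^ 2) (q ^ 2) q (r, s, t) =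
      quadrantSign s t * heckeDoubleTerm q q q s t *
        (q ^ (s + t) * (quadrantSign r (s + t) *
          thetaTerm (q ^ (2 * (s + t) + e + 1)) q r)) := by
  have h : heckeTripleTerm 1 2 1 2 2 1 (q ^ (e + 1)) (q ^ 2) (q ^ 2) q (r, s, t) =
      heckeDoubleTerm q q q s t *
        (q ^ (s + t) * thetaTerm (q ^ (2 * (s + t) + e + 1)) q r) := by
    simp only [heckeTripleTerm, heckeDoubleTerm, thetaTerm, ← zpow_natCast, ← zpow_mul]
    rw [add_assoc r, zpow_add₀ (by norm_num) r, mul_comm ((-1) ^ r)]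
    simp only [mul_assoc]
    congr 1
    simp only [mul_left_comm _ ((-1 : ℂ) ^ r)]
    congr 1
    simp only [← zpow_add₀ hq0]
    congr 1
    push_cast
    ring
  rw [octantInd_eq_mul, h]
  ring

/-! ### Partial theta series as sums of reciprocal q-factorials -/

section ConjugateBailey

variable {q : ℂ} (hq1 : ‖q‖ < 1)
include hq1

theorem exists_norm_pow_mul_invPoch_le :
    ∃ C, 0 ≤ C ∧ ∀ (n : ℕ) (k l : ℤ),
      ‖q ^ n * (invPoch q k * invPoch q l)‖ ≤ ‖q‖ ^ n * C := by
  obtain ⟨C, hC0, hC⟩ := exists_norm_invPoch_le hq1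
  refine ⟨C * C, mul_nonneg hC0 hC0, fun n k l => ?_⟩
  rw [norm_mul, norm_mul, norm_pow]
  gcongr
  · exact hC k
  · exact hC l

theorem summable_pow_mul_invPoch (k l : ℕ → ℤ) :
    Summable fun n : ℕ => q ^ n * (invPoch q (k n) * invPoch q (l n)) := by
  obtain ⟨C, -, hC⟩ := exists_norm_pow_mul_invPoch_le hq1
  exact Summable.of_norm_bounded
    ((summable_geometric_of_lt_one (norm_nonneg q) hq1).mul_right C) fun n => hC n _ _

theorem exists_norm_tsum_pow_mul_invPoch_le :
    ∃ C, ∀ k l : ℕ → ℤ, ‖∑' n : ℕ, q ^ n * (invPoch q (k n) * invPoch q (l n))‖ ≤ C := by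
  obtain ⟨C, -, hC⟩ := exists_norm_pow_mul_invPoch_le hq1
  have hs := (summable_geometric_of_lt_one (norm_nonneg q) hq1).mul_right C
  exact ⟨_, fun k l => tsum_of_norm_bounded hs.hasSum fun n => hC n _ _⟩

theorem mockTerm_eq (e n : ℕ) :
    q ^ n / qPoch (q ^ (n + 1)) q (n + e) =
      q ^ n * (qPoch q q n / qPoch q q (2 * n + e)) := by
  have h : qPoch q q (2 * n + e) = qPoch q q n * qPoch (q ^ (n + 1)) q (n + e) := by
    rw [show 2 * n + e = n + (n + e) by ring, qPoch, qPoch, qPoch, Finset.prod_range_add]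
    congr 1
    refine Finset.prod_congr rfl fun i _ => ?_
    ring
  have hp := qPoch_self_ne_zero hq1 n
  rw [h, div_mul_cancel_left₀ hp, div_eq_mul_inv]

theorem summable_mockTerm (e : ℕ) :
    Summable fun n : ℕ => q ^ n / qPoch (q ^ (n + 1)) q (n + e) := by
  obtain ⟨C, hC0, hC⟩ := exists_norm_invPoch_le hq1
  obtain ⟨B, hB⟩ := (tendsto_qPoch_self hq1).norm.bddAbove_range
  have hB' : ∀ n, ‖qPoch q q n‖ ≤ B := fun n => hB ⟨n, rfl⟩
  refine Summable.of_norm_bounded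
    ((summable_geometric_of_lt_one (norm_nonneg q) hq1).mul_right (B * C)) fun n => ?_
  rw [mockTerm_eq hq1, div_eq_mul_inv, ← invPoch_natCast, norm_mul, norm_mul, norm_pow]
  gcongr
  · exact (norm_nonneg _).trans (hB' 0)
  · exact hB' n
  · exact hC _

theorem tendsto_invPoch_mul_invPoch (K : ℕ) :
    Tendsto (fun n : ℕ => invPoch q (n - 1) * invPoch q (n + K)) atTop
      (𝓝 ((eulerJ 1 q ^ 2)⁻¹)) := by
  have hn : Tendsto (fun n : ℕ => (n : ℤ)) atTop atTop := tendsto_natCast_atTop_atTop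
  have h1 : Tendsto (fun n : ℕ => invPoch q (n - 1)) atTop (𝓝 (eulerJ 1 q)⁻¹) := by
    simp only [sub_eq_add_neg]
    exact (tendsto_invPoch hq1).comp (tendsto_atTop_add_const_right _ _ hn)
  have h2 : Tendsto (fun n : ℕ => invPoch q (n + K)) atTop (𝓝 (eulerJ 1 q)⁻¹) :=
    (tendsto_invPoch hq1).comp (tendsto_atTop_add_const_right _ _ hn)
  rw [pow_two, mul_inv]
  exact h1.mul h2

variable (hq0 : q ≠ 0)
include hq0

/-- Writing each lowered factor as (1 - q^k)/(q)_k, the difference on the right has numerator 1 - (1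
- q^n)(1 - q^{n+K+1}), which splits into the two terms on the left. -/
theorem pow_mul_invPoch_telescope (K n : ℕ) :
    q ^ n * (invPoch q n * invPoch q (n + K)) +
      q ^ (K + 1) * (q ^ n * (invPoch q n * invPoch q (n + (K + 1 : ℕ)))) =
      invPoch q n * invPoch q (n + (K + 1 : ℕ)) - invPoch q (n - 1) * invPoch q (n + K) := by
  have e1 := one_sub_zpow_mul_invPoch hq1 n
  have e2 := one_sub_zpow_mul_invPoch hq1 ((n : ℤ) + (K + 1 : ℕ))
  rw [show (n : ℤ) + (K + 1 : ℕ) - 1 = n + K by push_cast; ring] at e2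
  rw [← e1, ← e2, zpow_add₀ hq0, zpow_natCast, zpow_natCast]
  ring

theorem tsum_pow_mul_invPoch_add (K : ℕ) :
    (∑' n : ℕ, q ^ n * (invPoch q n * invPoch q (n + K))) +
      q ^ (K + 1) * ∑' n : ℕ, q ^ n * (invPoch q n * invPoch q (n + (K + 1 : ℕ))) =
      (eulerJ 1 q ^ 2)⁻¹ := by
  have h1 : Summable fun n : ℕ => q ^ n * (invPoch q n * invPoch q (n + K)) :=
    summable_pow_mul_invPoch hq1 _ _
  have h2 : Summable fun n : ℕ =>
      q ^ (K + 1) * (q ^ n * (invPoch q n * invPoch q (n + (K + 1 : ℕ)))) :=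
    (summable_pow_mul_invPoch hq1 _ _).mul_left _
  rw [← tsum_mul_left, ← h1.tsum_add h2]
  refine tendsto_nhds_unique (h1.add h2).hasSum.tendsto_sum_nat
    ((tendsto_invPoch_mul_invPoch hq1 K).congr fun n => ?_)
  simp only [pow_mul_invPoch_telescope hq1 hq0]
  induction n with
  | zero =>
    rw [invPoch_of_neg q (by norm_num), zero_mul, Finset.sum_range_zero]
  | succ n ih =>
    rw [Finset.sum_range_succ, ← ih, add_sub_cancel,
      show ((n + 1 : ℕ) : ℤ) - 1 = n by push_cast; ring,
      show ((n + 1 : ℕ) : ℤ) + K = n + (K + 1 : ℕ) by push_cast; ring]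

theorem summable_nat_thetaTerm {x : ℂ} (hx : x ≠ 0) : Summable fun t : ℕ => thetaTerm x q t :=
  (summable_thetaTerm hq0 hq1 hx).comp_injective Nat.cast_injective

theorem tsum_nat_thetaTerm {x : ℂ} (hx : x ≠ 0) :
    ∑' t : ℕ, thetaTerm x q t = 1 - x * ∑' t : ℕ, thetaTerm (x * q) q t := by
  rw [(summable_nat_thetaTerm hq1 hq0 hx).tsum_eq_zero_add, sub_eq_add_neg, ← tsum_mul_left,
    ← tsum_neg]
  congr 1
  · simp [thetaTerm]
  · refine tsum_congr fun t => ?_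
    simp only [thetaTerm]
    push_cast
    rw [intChooseTwo_add_one, zpow_add_one₀ (by norm_num), zpow_add_one₀ hx, zpow_add₀ hq0,
      mul_zpow]
    ring

/-- Both sides satisfy u_K = 1 - q^{K+1} u_{K+1}. Their difference d is bounded in K, and iterating
d_K = -q^{K+1} d_{K+1} forces it to vanish. -/
theorem tsum_pow_mul_invPoch (K : ℕ) :
    eulerJ 1 q ^ 2 * ∑' n : ℕ, q ^ n * (invPoch q n * invPoch q (n + K)) =
      ∑' t : ℕ, thetaTerm (q ^ (K + 1)) q t := by
  have hJ := eulerJ_one_ne_zero hq1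
  let d : ℕ → ℂ := fun K => eulerJ 1 q ^ 2 * (∑' n : ℕ, q ^ n * (invPoch q n * invPoch q (n + K)))
    - ∑' t : ℕ, thetaTerm (q ^ (K + 1)) q t
  have hd : ∀ K, d K = -q ^ (K + 1) * d (K + 1) := by
    intro K
    have h1 := tsum_pow_mul_invPoch_add hq1 hq0 K
    have h2 := tsum_nat_thetaTerm hq1 hq0 (pow_ne_zero (K + 1) hq0)
    rw [← pow_succ] at h2
    simp only [d]
    rw [h2, eq_sub_of_add_eq h1]
    field_simp
    ring
  obtain ⟨B, hB⟩ : ∃ B, ∀ K, ‖d K‖ ≤ B := by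
    obtain ⟨C, hC⟩ := exists_norm_tsum_pow_mul_invPoch_le hq1
    have hs : Summable fun t : ℕ => ‖thetaTerm q q t‖ :=
      (summable_norm_thetaTerm hq0 hq1 hq0).comp_injective Nat.cast_injective
    refine ⟨‖eulerJ 1 q ^ 2‖ * C + ∑' t : ℕ, ‖thetaTerm q q t‖, fun K =>
      (norm_sub_le _ _).trans (add_le_add ?_ ?_)⟩
    · rw [norm_mul]
      exact mul_le_mul_of_nonneg_left (hC _ _) (norm_nonneg _)
    · refine tsum_of_norm_bounded hs.hasSum fun t => ?_
      rw [norm_thetaTerm, norm_thetaTerm, norm_pow, zpow_natCast, zpow_natCast]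
      gcongr
      exact pow_le_of_le_one (norm_nonneg q) hq1.le (Nat.succ_ne_zero K)
  -- The weak bound |q|^{K+1} ≤ |q| at each iteration already gives geometric decay.
  have hdB : ∀ j K, ‖d K‖ ≤ ‖q‖ ^ j * B := by
    intro j
    induction j with
    | zero => simpa using hB
    | succ j ih =>
      intro K
      rw [hd K, norm_mul, norm_neg, norm_pow, pow_succ' ‖q‖ j, mul_assoc]
      exact mul_le_mul (pow_le_of_le_one (norm_nonneg q) hq1.le (Nat.succ_ne_zero K)) (ih (K + 1))
        (norm_nonneg _) (norm_nonneg _)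
  have h0 : ‖d K‖ ≤ 0 * B := ge_of_tendsto'
    ((tendsto_pow_atTop_nhds_zero_of_lt_one (norm_nonneg q) hq1).mul_const B) fun j => hdB j K
  rw [zero_mul, norm_le_zero_iff] at h0
  exact sub_eq_zero.1 h0

theorem tsum_pow_mul_invPoch_nat (e M : ℕ) :
    eulerJ 1 q ^ 2 * ∑' n : ℕ, q ^ n * (invPoch q (n - M) * invPoch q (n + e + M)) =
      q ^ M * ∑' t : ℕ, thetaTerm (q ^ (2 * M + e + 1)) q t := by
  have hs : Summable fun n : ℕ => q ^ n * (invPoch q (n - M) * invPoch q (n + e + M)) :=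
    summable_pow_mul_invPoch hq1 _ _
  rw [← tsum_pow_mul_invPoch hq1 hq0, mul_left_comm]
  congr 1
  rw [← hs.sum_add_tsum_nat_add M, Finset.sum_eq_zero, zero_add, ← tsum_mul_left]
  · refine tsum_congr fun n => ?_
    rw [show ((n + M : ℕ) : ℤ) - M = n by push_cast; ring,
      show ((n + M : ℕ) : ℤ) + e + M = n + (2 * M + e : ℕ) by push_cast; ring, pow_add]
    ring
  · intro n hn
    have := Finset.mem_range.1 hn
    rw [invPoch_of_neg q (k := (n : ℤ) - M) (by omega), zero_mul, mul_zero]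

theorem tsum_pow_mul_invPoch_int {e : ℕ} (he : e ≤ 1) (N : ℤ) :
    eulerJ 1 q ^ 2 * ∑' n : ℕ, q ^ n * (invPoch q (n - N) * invPoch q (n + e + N)) =
      q ^ N * ∑' r : ℤ, quadrantSign r N * thetaTerm (q ^ (2 * N + e + 1)) q r := by
  rcases le_or_gt 0 N with hN | hN
  · obtain ⟨M, rfl⟩ := Int.eq_ofNat_of_zero_le hN
    rw [tsum_pow_mul_invPoch_nat hq1 hq0, zpow_natCast]
    congr 1
    have hinj : Function.Injective (fun t : ℕ => (t : ℤ)) := Nat.cast_injective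
    rw [← hinj.tsum_eq]
    · refine tsum_congr fun t => ?_
      rw [quadrantSign, if_pos ⟨by positivity, hN⟩, one_mul, ← zpow_natCast]
      push_cast
      rfl
    · intro r hr
      by_contra h
      have hr' : r < 0 := by
        by_contra h'
        exact h ⟨r.toNat, by simp; omega⟩
      apply hr
      change quadrantSign r M * _ = 0
      rw [quadrantSign, if_neg (by omega), if_neg (by omega), zero_mul]
  -- The product of reciprocals is invariant under N ↦ -e-N. The assumption e ≤ 1 ensures that this
  -- is nonnegative for every N < 0.
  · obtain ⟨M, hM⟩ : ∃ M : ℕ, (M : ℤ) = -e - N := ⟨(-e - N).toNat, by omega⟩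
    have h := tsum_pow_mul_invPoch_nat hq1 hq0 e M
    rw [hM] at h
    have h1 : ∀ n : ℕ, q ^ n * (invPoch q (n - (-e - N)) * invPoch q (n + e + (-e - N))) =
        q ^ n * (invPoch q (n - N) * invPoch q (n + e + N)) := by
      intro n
      rw [mul_comm (invPoch q _), show (n : ℤ) + e + (-e - N) = n - N by ring,
        show (n : ℤ) - (-e - N) = n + e + N by ring]
    rw [tsum_congr h1] at h
    rw [h, ← tsum_mul_left, ← tsum_mul_left]
    have hinj : Function.Injective (fun t : ℕ => -1 - (t : ℤ)) := fun a b h => by simpa using h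
    rw [← hinj.tsum_eq]
    · refine tsum_congr fun t => ?_
      rw [quadrantSign, if_neg (by omega), if_pos (by omega), thetaTerm, thetaTerm,
        neg_one_zpow_eq_of_odd (m := -1 - t) (n := t) ⟨-1, by ring⟩, intChooseTwo_neg_one_sub,
        neg_one_mul, neg_mul, neg_mul, neg_neg, mul_assoc, mul_assoc, mul_left_comm,
        mul_left_comm (q ^ N)]
      congr 1
      simp only [← zpow_natCast, ← zpow_mul, ← zpow_add₀ hq0]
      congr 1
      push_cast
      rw [hM]
      ring
    · intro r hr
      by_contra h
      have hr' : 0 ≤ r := by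
        by_contra h'
        exact h ⟨(-1 - r).toNat, by simp; omega⟩
      apply hr
      simp only
      rw [quadrantSign, if_neg (by omega), if_neg (by omega), zero_mul, mul_zero]

/-- Absolute summability of `heckeDiag`, the uniform bound on `invPoch` and the geometric factor q^n
justify exchanging the two sums. -/
theorem tsum_heckeDiag_mul_tsum (e : ℕ) :
    ∑' N, heckeDiag q N * ∑' n : ℕ, q ^ n * (invPoch q (n - N) * invPoch q (n + e + N)) =
      ∑' n : ℕ, q ^ n * binomSum q n (n + e) (heckeDiag q) := by
  obtain ⟨B, hB0, hB⟩ := exists_norm_pow_mul_invPoch_le hq1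
  have hs : Summable fun p : ℤ × ℕ => heckeDiag q p.1 *
      (q ^ p.2 * (invPoch q (p.2 - p.1) * invPoch q (p.2 + e + p.1))) := by
    refine Summable.of_norm_bounded ((summable_norm_heckeDiag hq1 hq0).mul_of_nonneg
      ((summable_geometric_of_lt_one (norm_nonneg q) hq1).mul_right B) (fun _ => norm_nonneg _)
      (fun _ => by positivity)) fun p => ?_
    rw [norm_mul]
    exact mul_le_mul_of_nonneg_left (hB _ _ _) (norm_nonneg _)
  have h1 : ∀ N, heckeDiag q N *
      ∑' n : ℕ, q ^ n * (invPoch q (n - N) * invPoch q (n + e + N)) =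
      ∑' n : ℕ, heckeDiag q N * (q ^ n * (invPoch q (n - N) * invPoch q (n + e + N))) :=
    fun N => tsum_mul_left.symm
  have h2 : ∀ n : ℕ, q ^ n * binomSum q n (n + e) (heckeDiag q) =
      ∑' N, heckeDiag q N * (q ^ n * (invPoch q (n - N) * invPoch q (n + e + N))) := by
    intro n
    rw [binomSum_apply, ← tsum_mul_left]
    exact tsum_congr fun N => mul_left_comm _ _ _
  rw [tsum_congr h1, tsum_congr h2]
  exact (Summable.tsum_comm (f := fun (N : ℤ) (n : ℕ) => heckeDiag q N *
    (q ^ n * (invPoch q (n - N) * invPoch q (n + e + N)))) hs).symm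

theorem heckeTriple_eq_tsum_prod (x y z : ℂ) (hx : x ≠ 0) (hy : y ≠ 0) (hz : z ≠ 0) :
    heckeTriple 1 2 1 2 2 1 x y z q = ∑' p : ℤ × ℤ, ∑' r : ℤ,
      octantInd r p.1 p.2 * heckeTripleTerm 1 2 1 2 2 1 x y z q (r, p.1, p.2) := by
  have hs := summable_heckeTriple hq0 hq1 hx hy hz
  rw [heckeTriple_eq_tsum hq0 hq1 hx hy hz]
  exact ((Equiv.prodComm (ℤ × ℤ) ℤ).tsum_eq _).symm.trans
    ((Equiv.prodComm (ℤ × ℤ) ℤ).summable_iff.2 hs).tsum_prod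

/-- The inner sum over r is replaced by its reciprocal q-factorial expansion, the pairs (s, t) are
collected by N = s + t, and the sums over N and n are exchanged. -/
theorem heckeTriple_eq_tsum_binomSum {e : ℕ} (he : e ≤ 1) :
    heckeTriple 1 2 1 2 2 1 (q ^ (e + 1)) (q ^ 2) (q ^ 2) q =
      eulerJ 1 q ^ 2 * ∑' n : ℕ, q ^ n * binomSum q n (n + e) (heckeDiag q) := by
  have he0 : q ^ (e + 1) ≠ 0 := pow_ne_zero _ hq0
  have h20 : q ^ 2 ≠ 0 := pow_ne_zero _ hq0
  obtain ⟨C, hC⟩ := exists_norm_tsum_pow_mul_invPoch_le hq1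
  rw [heckeTriple_eq_tsum_prod hq1 hq0 _ _ _ he0 h20 h20, ← tsum_heckeDiag_mul_tsum hq1 hq0,
    ← tsum_heckeDiag_mul hq1 hq0 (φ := fun N =>
      ∑' n : ℕ, q ^ n * (invPoch q (n - N) * invPoch q (n + e + N))) fun N => hC _ _,
    ← tsum_mul_left]
  refine tsum_congr fun p => ?_
  rw [mul_left_comm, tsum_pow_mul_invPoch_int hq1 hq0 he, ← tsum_mul_left, ← tsum_mul_left]
  exact tsum_congr fun r => octantInd_mul_heckeTripleTerm hq0 e r p.1 p.2

/-! ### The mock theta functions -/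

theorem heckeTriple_eq_chi0 :
    heckeTriple 1 2 1 2 2 1 q (q ^ 2) (q ^ 2) q = eulerJ 1 q ^ 2 * chi0 q := by
  have h := heckeTriple_eq_tsum_binomSum hq1 hq0 (e := 0) zero_le_one
  rw [zero_add, pow_one] at h
  rw [h, chi0]
  congr 1
  refine tsum_congr fun n => ?_
  rw [Nat.cast_zero, add_zero, binomSum_heckeDiag_eq hq1 hq0]
  exact (mockTerm_eq hq1 0 n).symm

theorem heckeTriple_eq_chi1 :
    heckeTriple 1 2 1 2 2 1 (q ^ 2) (q ^ 2) (q ^ 2) q = eulerJ 1 q ^ 2 * chi1 q := by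
  rw [heckeTriple_eq_tsum_binomSum hq1 hq0 (e := 1) le_rfl, chi1]
  congr 1
  refine tsum_congr fun n => ?_
  rw [Nat.cast_one, binomSum_heckeDiag_odd_eq hq1 hq0]
  exact (mockTerm_eq hq1 1 n).symm

end ConjugateBailey

end

/-- The first group of conjuncts records that all infinite sums and products involved converge;
the second group consists of the five evaluations. -/
theorem corollary1p1 (q : ℂ) (hq0 : q ≠ 0) (hq1 : ‖q‖ < 1) :
    ((∀ x y z : ℂ, x ≠ 0 → y ≠ 0 → z ≠ 0 →
        Summable (fun p : nonnegOctant => heckeTripleTerm 1 2 1 2 2 1 x y z q p) ∧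
        Summable (fun p : negOctant => heckeTripleTerm 1 2 1 2 2 1 x y z q p)) ∧
      Multipliable (fun i : ℕ => 1 - q ^ (1 * (i + 1))) ∧
      Summable (chi0Term q) ∧ Summable (chi1Term q)) ∧
    heckeTriple 1 2 1 2 2 1 (q ^ 3) (q ^ 3) (q ^ 3) q = 0 ∧
    heckeTriple 1 2 1 2 2 1 q q (q ^ 2) q = eulerJ 1 q ^ 2 ∧
    heckeTriple 1 2 1 2 2 1 q (q ^ 2) (q ^ 2) q = eulerJ 1 q ^ 2 * chi0 q ∧
    heckeTriple 1 2 1 2 2 1 q q (q ^ 3) q = eulerJ 1 q ^ 2 * (q * chi0 q + 1 - q) ∧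
    heckeTriple 1 2 1 2 2 1 q (q ^ 2) (q ^ 3) q = eulerJ 1 q ^ 2 * (q * chi1 q + 1) := by
  refine ⟨⟨fun x y z hx hy hz => ⟨summable_nonnegOctant hq0 hq1 hx hy hz,
    summable_negOctant hq0 hq1 hx hy hz⟩, ?_, summable_mockTerm hq1 0,
    summable_mockTerm hq1 1⟩, heckeTriple_cube hq0 hq1, ?_, heckeTriple_eq_chi0 hq1 hq0, ?_, ?_⟩
  · simpa only [one_mul] using ModularForm.multipliable_one_sub_pow hq1
  · rw [heckeTriple_self_self_sq hq0 hq1, heckeDouble_self_self hq1 hq0]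
  · rw [heckeTriple_self_self_cube hq0 hq1, heckeTriple_eq_chi0 hq1 hq0,
      heckeDouble_self_self hq1 hq0]
    ring
  · rw [heckeTriple_self_sq_cube hq0 hq1, heckeTriple_eq_chi1 hq1 hq0,
      heckeDouble_self_self hq1 hq0]
    ring
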